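/- **Model.** Two tiers of base stations (BSs), small cells ($s$) and macro cells ($m$), form independent homogeneous Poisson point processes $\Phi_s,\Phi_m$ in $\mathbb R^2$ with densities $\lambda_s,\lambda_m>0$; the typical user is at the origin. A link of length $r$ is line-of-sight (L), independently for each BS, with probability $\mathcal P_{L}(r)=\min(18/r,1)(1-e^{-\beta r})+e^{-\beta r}$, $\beta\ge 0$, and non-line-of-sight (NL) with probability $\mathcal P_{NL}=1-\mathcal P_L$; a link of type $t\in\{L,NL\}$ has path loss $A_t r^{-\alpha_t}$ with $A_t>0$. Assume $\alpha_L>1$ (and $\alpha_L>2$ if $\beta=0$) and $\alpha_{NL}>2$, so that the interference is finite. The power fadings of all links are independent, exponentially distributed with mean $1$, and independent of positions and link types. The transmit powers are $P_m^{tr}=(P_m^{tot}-P_m^{fc}-w_{ca}F)/\rho_m>0$ and $P_s^{tr}=(P_s^{tot}-P_s^{fc}-w_{ca}C)/\rho_s>0$, where $P_k^{tot}$ is the total power and $P_k^{fc}$ the circuit power of a tier-$k$ BS, $\rho_k$ its amplifier coefficient, $w_{ca}$ the caching power coefficient, and $F$ and $C$ the numbers of files cached in a macro and a small cell; the bias factors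 are $B_m,B_s>0$, and the noise power is $N_0\ge 0$. The association rule compares the biased powers $P_k^{tr}B_k h_k A_t r^{-\alpha_t}$ with fixed fading levels $h_m,h_s>0$ (for instance both equal to $1$). Write $S_{k,t}(r)=P_k^{tr}B_kA_tr^{-\alpha_t}$. For an MBS serving link of type $t$ and length $r$, let $\mathrm{SINR}^t_m(r)=h_0S_{m,t}(r)/(I'_s+I'_m+N_0)$, where $h_0$ is the fading of the serving link and $I'_k$ is the sum of the faded biased powers of all tier-$k$ BSs that, by the association rule, are not stronger than the serving BS. The association law $F_m^t(r)\,dr$ is the law of the distance to the nearest MBS, multiplied by $\mathcal P_t(r)$ and by the three probabilities that the serving link is, by the association rule, at least as strong as: an MBS link of the other type of length $R_m$; an L link to an SBS of length $R_s$; an NL link to an SBS of length $R_s$. Here $R_k$ denotes the distance from the origin to the nearest point of $\Phi_k$. Let $$P^{cov}_{m,t}(\gamma)=\mathbb E_r\big[\mathbb P[\mathrm{SINR}_m^t(r)\ge\gamma]\big]=\int_0^\infty \mathbb P[\mathrm{SINR}_m^t(r)\ge\gamma]\,F_m^t(r)\,dr .$$ The MBS-tier average potential throughput with total bandwidth $W$,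 access share $\eta\in[0,1]$ and threshold $\gamma_0>0$ is $\mathcal R_m(\eta,\gamma_0)=\lambda_m W_m\log_2(1+\gamma_0)\,\mathbb P\{\mathrm{SINR}_m\ge\gamma_0\}$ with $W_m=\eta W$, where $\mathbb P\{\mathrm{SINR}_m\ge\gamma_0\}$ is the measure of the coverage event when the type and length $(t,r)$ of the serving link are drawn from the association law $(F_m^L,F_m^{NL})$ independently of the BSs and fadings that determine $\mathrm{SINR}_m^t(r)$. **Claim.** $$\mathcal R_m(\eta,\gamma_0)=\lambda_m\eta W\log_2(1+\gamma_0)\,P^{cov}_{m,L}(\gamma_0)+\lambda_m\eta W\log_2(1+\gamma_0)\,P^{cov}_{m,NL}(\gamma_0),$$ and for $t\in\{L,NL\}$ $$P^{cov}_{m,t}(\gamma_0)=\int_0^\infty \exp\Big(\frac{-\gamma_0N_0}{S_{m,t}(r)}\Big)\,\mathcal L^t_{m}(r)\,F_m^t(r)\,dr,$$ where, with $c^{t}_{k,u}(r)=\Big(\frac{P_m^{tr}B_mh_mA_t}{P_k^{tr}B_kh_kA_u}\Big)^{-1/\alpha_u}r^{\alpha_t/\alpha_u}$ and $\bar t$ the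 type other than $t$, $$F_m^t(r)=e^{-\lambda_m\pi c^t_{m,\bar t}(r)^2}\,e^{-\lambda_s\pi c^t_{s,L}(r)^2}\,e^{-\lambda_s\pi c^t_{s,NL}(r)^2}\;\mathcal P_t(r)\,e^{-\pi r^2\lambda_m}\,2\pi r\lambda_m ,$$ $$\mathcal L_m^t(r)=\prod_{k\in\{s,m\}}\exp\Big(-2\pi\lambda_k\sum_{u\in\{L,NL\}}\int_{c^t_{k,u}(r)}^\infty\frac{\mathcal P_u(x)\,x}{1+\frac{S_{m,t}(r)}{\gamma_0S_{k,u}(x)}}\,dx\Big).$$ -/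

import Mathlib

open MeasureTheory ProbabilityTheory
open scoped ENNReal

namespace HetNet

/-- The two tiers of base stations (BSs): small-cell BSs (SBS) and macro-cell BSs (MBS). -/
inductive Tier : Type
  | sbs
  | mbs

/-- Propagation condition of a link: line of sight, or non line of sight. -/
inductive Path : Type
  | los
  | nlos

instance : MeasurableSpace Path := ⊤

def Path.other : Path → Path
  | .los => .nlos
  | .nlos => .los

/-- Positions in the plane. -/
abbrev Plane : Type := EuclideanSpace ℝ (Fin 2)

noncomputable section

/-- The deterministic parameters of the network. -/
structure Params where
  /-- densities `λ_s`, `λ_m` of the two tiers -/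
  density : Tier → ℝ
  /-- total power consumption of a BS -/
  totalPower : Tier → ℝ
  /-- fixed circuit power of a BS -/
  circuitPower : Tier → ℝ
  /-- power amplifier and cooling coefficients `ρ_s`, `ρ_m` -/
  amplifier : Tier → ℝ
  /-- caching power coefficient `w_ca` -/
  cachingPower : ℝ
  /-- cache capacity `C` of an SBS -/
  cacheCapacity : ℕ
  /-- number `F` of files in the library, all of which are stored in every MBS -/
  numFiles : ℕ
  /-- association bias factors `B_s`, `B_m` -/
  bias : Tier → ℝ
  /-- fixed fading levels `h_s`, `h_m` used by the association rule
  (both equal to `1` for association by mean received power) -/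
  assocFading : Tier → ℝ
  /-- path loss constants `A_L`, `A_NL` -/
  gain : Path → ℝ
  /-- path loss exponents `α_L`, `α_NL` -/
  exponent : Path → ℝ
  /-- blockage parameter `β` -/
  blockage : ℝ
  /-- noise power `N_0` -/
  noise : ℝ
  /-- total bandwidth `W` -/
  bandwidth : ℝ

namespace Params

variable (p : Params)

/-- Number of files stored in a BS. -/
def stored : Tier → ℕ
  | .sbs => p.cacheCapacity
  | .mbs => p.numFiles

/-- Transmit power `P_k^tr`: what is left of the total power after circuits and caching. -/
def txPower (k : Tier) : ℝ :=
  (p.totalPower k - p.circuitPower k - p.cachingPower * p.stored k) / p.amplifier k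

/-- LoS probability `min (18 / r) 1 * (1 - exp (-β r)) + exp (-β r)` at distance `r`, and the
complementary NLoS probability. -/
def pathProb : Path → ℝ → ℝ
  | .los, r => min (18 / r) 1 * (1 - Real.exp (-p.blockage * r)) + Real.exp (-p.blockage * r)
  | .nlos, r =>
      1 - (min (18 / r) 1 * (1 - Real.exp (-p.blockage * r)) + Real.exp (-p.blockage * r))

/-- Path loss `A_t r ^ (-α_t)` of a link of type `t` and length `r`. -/
def pathLoss (t : Path) (r : ℝ) : ℝ := p.gain t * r ^ (-p.exponent t)

/-- Biased power `P_k B_k A_t r ^ (-α_t)` received from a BS of tier `k` over a link of type `t`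
and length `r`, up to the fading factor. -/
def rxPower (k : Tier) (t : Path) (r : ℝ) : ℝ := p.txPower k * p.bias k * p.pathLoss t r

/-- Biased power as it is used by the association rule. -/
def assocPower (k : Tier) (t : Path) (r : ℝ) : ℝ := p.assocFading k * p.rxPower k t r

end Params

variable {Ω : Type*}

/-- The random elements of the network, seen from the typical user at the origin.
The BSs of tier `k` are enumerated as `pos k 0, pos k 1, …`. -/
structure Network (Ω : Type*) where
  /-- positions of the BSs -/
  pos : Tier → ℕ → Ω → Plane
  /-- uniform variables that decide which links are LoS -/
  obstacle : Tier → ℕ → Ω → ℝ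
  /-- small-scale fadings of the interfering links -/
  fading : Tier → ℕ → Ω → ℝ
  /-- small-scale fading of the serving link -/
  servingFading : Ω → ℝ

/-- The sequence `X` of random points forms a Poisson point process with intensity measure `ν`:
the number of points in a set of finite intensity is Poisson distributed, and the numbers of
points in disjoint sets are independent. -/
def IsPoissonPoints [MeasurableSpace Ω] (P : Measure Ω) (X : ℕ → Ω → Plane)
    (ν : Measure Plane) : Prop :=
  (∀ i, Measurable (X i)) ∧
  (∀ A : Set Plane, MeasurableSet A → ν A ≠ ∞ →
    P.map (fun ω => Measure.sum (fun i => Measure.dirac (X i ω)) A) =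
      (poissonMeasure (ν A).toNNReal).map (fun n : ℕ => (n : ℝ≥0∞))) ∧
  (∀ (n : ℕ) (A : Fin n → Set Plane), (∀ j, MeasurableSet (A j)) →
    Pairwise (fun j l => Disjoint (A j) (A l)) →
    iIndepFun (fun j ω => Measure.sum (fun i => Measure.dirac (X i ω)) (A j)) P)

namespace Network

variable (N : Network Ω) (p : Params)

/-- All marks of the network: the serving fading, the obstacle variables, the other fadings. -/
def mark : Unit ⊕ ((Tier × ℕ) ⊕ (Tier × ℕ)) → Ω → ℝ
  | .inl _ => N.servingFading
  | .inr (.inl (k, i)) => N.obstacle k i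
  | .inr (.inr (k, i)) => N.fading k i

/-- The probabilistic model: two independent homogeneous Poisson point processes with densities
`λ_s`, `λ_m`, independent uniform obstacle variables and independent unit-mean exponential
(Rayleigh) power fadings, the marks being independent of the positions. -/
structure IsModel [MeasurableSpace Ω] (P : Measure Ω) : Prop where
  poisson : ∀ k, IsPoissonPoints P (N.pos k) (ENNReal.ofReal (p.density k) • volume)
  indep_tiers : iIndepFun (fun (k : Tier) (ω : Ω) (i : ℕ) => N.pos k i ω) P
  measurable_mark : ∀ j, Measurable (N.mark j)
  obstacle_law : ∀ k i, P.map (N.obstacle k i) = volume.restrict (Set.Icc (0 : ℝ) 1)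
  fading_law : ∀ k i, P.map (N.fading k i) = expMeasure 1
  servingFading_law : P.map N.servingFading = expMeasure 1
  indep_marks : iIndepFun N.mark P
  indep_pos_marks : IndepFun (fun (ω : Ω) (k : Tier) (i : ℕ) => N.pos k i ω)
    (fun (ω : Ω) j => N.mark j ω) P

/-- Propagation condition between the typical user and the `i`-th BS of tier `k`: at distance `d`
it is LoS with probability `pathProb los d`. -/
def linkPath (k : Tier) (i : ℕ) (ω : Ω) : Path :=
  open Classical in
  if N.obstacle k i ω ≤ p.pathProb .los ‖N.pos k i ω‖ then .los else .nlos

/-- Distance from the typical user to the nearest BS of tier `k`. -/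
def nearest (k : Tier) (ω : Ω) : ℝ := ⨅ i, ‖N.pos k i ω‖

/-- Interference from tier `k` when the typical user is served by an MBS over a link of type `t`
and length `r`. Since the user is associated with the strongest BS, the interfering BSs are those
whose biased power, as used by the association rule, does not exceed that of the serving MBS. -/
def interference (k : Tier) (t : Path) (r : ℝ) (ω : Ω) : ℝ≥0∞ :=
  open Classical in
  ∑' i : ℕ,
    if p.assocPower k (N.linkPath p k i ω) ‖N.pos k i ω‖ ≤ p.assocPower .mbs t r then
      ENNReal.ofReal
        (N.fading k i ω * p.rxPower k (N.linkPath p k i ω) ‖N.pos k i ω‖)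
    else 0

/-- SINR of the typical user served by an MBS over a link of type `t` and length `r`. -/
def sinr (t : Path) (r : ℝ) (ω : Ω) : ℝ≥0∞ :=
  ENNReal.ofReal (N.servingFading ω * p.rxPower .mbs t r) /
    (N.interference p .sbs t r ω + N.interference p .mbs t r ω + ENNReal.ofReal p.noise)

variable [MeasurableSpace Ω] (P : Measure Ω)

/-- Probability that an MBS at distance `r` with a link of type `t` is at least as strong as a BS
that is located at the distance of the nearest BS of tier `k` and has a link of type `u`. -/
def beatProb (t : Path) (k : Tier) (u : Path) (r : ℝ) : ℝ :=
  P.real {ω | p.assocPower k u (N.nearest k ω) ≤ p.assocPower .mbs t r}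

/-- The association law of the MBS tier, on pairs (link type `t`, length `r` of the serving link):
the law of the distance to the nearest MBS, weighted with the probability that this link has type
`t` and with the probabilities that it is at least as strong as an MBS link of the other type, an
LoS SBS link and an NLoS SBS link. -/
def assocLaw (t : Path) : Measure ℝ :=
  (P.map (N.nearest .mbs)).withDensity fun r => ENNReal.ofReal
    (N.beatProb p P t .mbs t.other r * N.beatProb p P t .sbs .los r *
      N.beatProb p P t .sbs .nlos r * p.pathProb t r)

/-- Joint association law of the type and the length of the serving link. -/
def linkLaw : Measure (Path × ℝ) :=
  (Measure.dirac Path.los).prod (N.assocLaw p P .los) +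
    (Measure.dirac Path.nlos).prod (N.assocLaw p P .nlos)

/-- `P{SINR ≥ γ}` for the MBS tier: the serving link is drawn from the association law, the
fadings and the interferers from the network. -/
def tierCoverage (γ : ℝ) : ℝ :=
  ((N.linkLaw p P).prod P).real {z | ENNReal.ofReal γ ≤ N.sinr p z.1.1 z.1.2 z.2}

/-- `E_r[P[SINR^t(r) ≥ γ]]`, the probability that the user is covered by an MBS over a link of
type `t`. -/
def pathCoverage (t : Path) (γ : ℝ) : ℝ :=
  ∫ r, P.real {ω | ENNReal.ofReal γ ≤ N.sinr p t r ω} ∂(N.assocLaw p P t)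

/-- Average potential throughput `λ_m W_m log₂(1 + γ) P{SINR ≥ γ}` of the MBS tier, which operates
on the access bandwidth `W_m = η W`. -/
def throughput (η γ : ℝ) : ℝ :=
  p.density .mbs * (η * p.bandwidth) * Real.logb 2 (1 + γ) * N.tierCoverage p P γ

end Network

namespace Params

variable (p : Params)

/-- The distance
`((P_m B_m h_m A_t) / (P_k B_k h_k A_u)) ^ (-1 / α_u) * r ^ (α_t / α_u)`, at which a BS of tier `k`
with a link of type `u` is as strong as an MBS at distance `r` with a link of type `t`. -/
def exclusion (t : Path) (k : Tier) (u : Path) (r : ℝ) : ℝ :=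
  ((p.txPower .mbs * p.bias .mbs * p.assocFading .mbs * p.gain t) /
      (p.txPower k * p.bias k * p.assocFading k * p.gain u)) ^ (-1 / p.exponent u) *
    r ^ (p.exponent t / p.exponent u)

/-- Closed form of the association density `F_m^t(r)`. -/
def assocDensity (t : Path) (r : ℝ) : ℝ :=
  Real.exp (-p.density .mbs * Real.pi * p.exclusion t .mbs t.other r ^ 2) *
  Real.exp (-p.density .sbs * Real.pi * p.exclusion t .sbs .los r ^ 2) *
  Real.exp (-p.density .sbs * Real.pi * p.exclusion t .sbs .nlos r ^ 2) *
  (p.pathProb t r * Real.exp (-Real.pi * r ^ 2 * p.density .mbs) *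
    (2 * Real.pi * r * p.density .mbs))

/-- Contribution of the BSs of tier `k` with links of type `u` to the exponent of the Laplace
transform of the interference. -/
def interferenceIntegral (t : Path) (k : Tier) (u : Path) (γ r : ℝ) : ℝ :=
  ∫ x in Set.Ioi (p.exclusion t k u r),
    p.pathProb u x * x / (1 + p.rxPower .mbs t r / (γ * p.rxPower k u x))

/-- Laplace transform of the interference at a user that is served by an MBS. -/
def laplace (t : Path) (γ r : ℝ) : ℝ :=
  Real.exp (-2 * Real.pi * p.density .sbs *
    (p.interferenceIntegral t .sbs .los γ r + p.interferenceIntegral t .sbs .nlos γ r)) *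
  Real.exp (-2 * Real.pi * p.density .mbs *
    (p.interferenceIntegral t .mbs .los γ r + p.interferenceIntegral t .mbs .nlos γ r))

/-- Closed form of the coverage probability `P_{m,t}^{cov}(γ)`. -/
def coverageIntegral (t : Path) (γ : ℝ) : ℝ :=
  ∫ r in Set.Ioi (0 : ℝ),
    Real.exp (-γ * p.noise / p.rxPower .mbs t r) * p.laplace t γ r * p.assocDensity t r

end Params

end

end HetNet

open Filter Topology

namespace HetNet

/-! Fix the type `t` and length `r` of the serving link, let `S` be its biased power and `θ = γ /
S`. The serving fading is a unit exponential independent of the interference `I`, so coverage given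
`I` has probability `exp (-θ (I + N₀))`. Averaging leaves the noise factor times the Laplace
transform of `I` at `θ`.

Given the positions, different BSs carry independent marks, so this transform is a product of
factors `1 - bsLoss` over the BSs: the exponential fading contributes `θ s / (1 + θ s)` for an
admissible link of power `s`, and the uniform obstacle variable averages over the two link types
(`prob_marks`). The product over the points is then averaged by the Laplace functional of a Poisson
process (`IsPoissonPoints.laplace_functional`) applied to `-log (1 - bsLoss)`. This gives the
exponential of minus the integrated loss for each tier (`prob_coverage`), which polar coordinates
turn into `interferenceIntegral`.

Biased power decreases with distance, so the association rule amounts to comparing distances with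
`exclusion` (`assocPower_le_iff`). This fixes the lower limits of these integrals and, with the
Poisson void probabilities, the association density (`assocLaw_eq`). The throughput formula is
additivity over the two link types (`tierCoverage_eq`).

Interference and exponents live in `[0, ∞]`, so limits and infinite products need no finiteness. The
conditions relating the exponents to 2 serve only to make the final integrals converge. -/

/-! ### The exponential and logarithm on `[0, ∞]`, and the Poisson generating function. -/

/-- The function `x ↦ exp (-x)` on `[0, ∞]`. -/
noncomputable def expNeg (x : ℝ≥0∞) : ℝ≥0∞ := EReal.exp (-(x : EReal))

lemma expNeg_zero : expNeg 0 = 1 := by simp [expNeg]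

lemma expNeg_top : expNeg ∞ = 0 := by simp [expNeg]

lemma expNeg_add (x y : ℝ≥0∞) : expNeg (x + y) = expNeg x * expNeg y := by
  rw [expNeg, expNeg, expNeg, ← EReal.exp_add, EReal.coe_ennreal_add,
    EReal.neg_add (.inl (EReal.coe_ennreal_ne_bot x)) (.inr (EReal.coe_ennreal_ne_bot y)),
    sub_eq_add_neg]

lemma expNeg_ofReal {x : ℝ} (hx : 0 ≤ x) :
    expNeg (ENNReal.ofReal x) = ENNReal.ofReal (Real.exp (-x)) := by
  rw [expNeg, EReal.coe_ennreal_ofReal, max_eq_left hx, ← EReal.coe_neg, EReal.exp_coe]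

lemma expNeg_antitone : Antitone expNeg := fun x y h => by
  simpa [expNeg] using h

lemma expNeg_le_one (x : ℝ≥0∞) : expNeg x ≤ 1 :=
  expNeg_zero ▸ expNeg_antitone bot_le

lemma continuous_expNeg : Continuous expNeg :=
  ENNReal.continuous_exp.comp (continuous_neg.comp continuous_coe_ennreal_ereal)

@[fun_prop]
lemma measurable_expNeg : Measurable expNeg := continuous_expNeg.measurable

lemma expNeg_sum {ι : Type*} (s : Finset ι) (f : ι → ℝ≥0∞) :
    expNeg (∑ i ∈ s, f i) = ∏ i ∈ s, expNeg (f i) := by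
  classical
  induction s using Finset.induction_on with
  | empty => simp [expNeg_zero]
  | insert a s ha ih => rw [Finset.sum_insert ha, Finset.prod_insert ha, expNeg_add, ih]

lemma tendsto_prod_expNeg {ι : Type*} (f : ι → ℝ≥0∞) :
    Tendsto (fun s : Finset ι => ∏ i ∈ s, expNeg (f i)) atTop (𝓝 (expNeg (∑' i, f i))) := by
  simp_rw [← expNeg_sum]
  exact (continuous_expNeg.tendsto _).comp ENNReal.summable.hasSum

lemma expNeg_nat_mul (n : ℕ) (a : ℝ≥0∞) : expNeg (n * a) = expNeg a ^ n := by
  have := expNeg_sum (Finset.range n) (fun _ => a)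
  simpa using this

/-- The function `x ↦ -log x`, inverse to `expNeg` on `[0, 1]`. -/
noncomputable def negLog (x : ℝ≥0∞) : ℝ≥0∞ := (-(ENNReal.log x)).toENNReal

/-- The bound matters because `toENNReal` truncates: above 1 the value of `-log` is negative and is
lost. -/
lemma expNeg_negLog {x : ℝ≥0∞} (hx : x ≤ 1) : expNeg (negLog x) = x := by
  have h : 0 ≤ -(ENNReal.log x) := by
    rw [EReal.le_neg]; simpa using hx
  rw [expNeg, negLog, EReal.coe_toENNReal h, neg_neg, ENNReal.exp_log]

@[fun_prop]
lemma measurable_negLog : Measurable negLog := by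
  unfold negLog
  exact (measurable_neg.comp ENNReal.measurable_log).ereal_toENNReal

/-- Exponential series. The case `q = 0` is included and later yields void probabilities. -/
lemma lintegral_pow_poissonMeasure (r : NNReal) {q : ℝ≥0∞} (hq : q ≤ 1) :
    ∫⁻ n : ℕ, q ^ n ∂(poissonMeasure r) = expNeg ((1 - q) * r) := by
  have hq' : q ≠ ∞ := ne_top_of_le_ne_top ENNReal.one_ne_top hq
  lift q to NNReal using hq'
  have hq1 : q ≤ 1 := by exact_mod_cast hq
  rw [poissonMeasure, lintegral_sum_measure]
  simp only [lintegral_smul_measure, lintegral_dirac, smul_eq_mul]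
  have h2 : HasSum (fun n : ℕ => Real.exp (-r) * ((r * q : ℝ) ^ n / n.factorial))
      (Real.exp (-r) * Real.exp (r * q)) := by
    apply HasSum.mul_left
    rw [Real.exp_eq_exp_ℝ]
    exact NormedSpace.expSeries_div_hasSum_exp _
  have h3 : ((1 - (q : ℝ≥0∞)) * r) = ENNReal.ofReal ((1 - (q : ℝ)) * (r : ℝ)) := by
    rw [ENNReal.ofReal_mul (by simpa using hq1), ENNReal.ofReal_sub _ q.coe_nonneg]
    simp
  rw [h3, expNeg_ofReal (mul_nonneg (by simpa using hq1) r.coe_nonneg)]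
  have h4 : Real.exp (-((1 - (q : ℝ)) * r)) = Real.exp (-r) * Real.exp (r * q) := by
    rw [← Real.exp_add]; congr 1; ring
  rw [h4, ← h2.tsum_eq, ENNReal.ofReal_tsum_of_nonneg (fun n => by positivity) h2.summable]
  congr 1; ext n
  rw [← ENNReal.ofReal_coe_nnreal (p := q), ← ENNReal.ofReal_pow q.coe_nonneg,
    ← ENNReal.ofReal_mul (by positivity)]
  congr 1
  rw [mul_pow]; ring

/-! ### The Laplace functional of a Poisson process. -/

section LaplaceFunctional

variable {Ω : Type*}

/-- The counting measure of the points of the sequence `X`. -/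
noncomputable def pointMeasure (X : ℕ → Ω → Plane) (ω : Ω) : Measure Plane :=
  Measure.sum fun i => Measure.dirac (X i ω)

lemma lintegral_pointMeasure (X : ℕ → Ω → Plane) (ω : Ω) {F : Plane → ℝ≥0∞} (hF : Measurable F) :
    ∫⁻ x, F x ∂(pointMeasure X ω) = ∑' i, F (X i ω) := by
  rw [pointMeasure, lintegral_sum_measure]
  exact tsum_congr fun i => lintegral_dirac' _ hF

variable [MeasurableSpace Ω]

lemma measurable_pointMeasure_apply {X : ℕ → Ω → Plane} (hX : ∀ i, Measurable (X i))
    {A : Set Plane} (hA : MeasurableSet A) : Measurable fun ω => pointMeasure X ω A := by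
  simp_rw [pointMeasure, Measure.sum_apply _ hA, Measure.dirac_apply' _ hA]
  exact Measurable.tsum fun i => (measurable_one.indicator hA).comp (hX i)

variable {P : Measure Ω} {X : ℕ → Ω → Plane} {ν : Measure Plane}

/-- The Poisson generating function at `q = expNeg v`. The value `v = ∞` is allowed. -/
lemma IsPoissonPoints.lintegral_expNeg_mul_apply (hX : IsPoissonPoints P X ν) {A : Set Plane}
    (hA : MeasurableSet A) (hν : ν A ≠ ∞) (v : ℝ≥0∞) :
    ∫⁻ ω, expNeg (v * pointMeasure X ω A) ∂P = expNeg ((1 - expNeg v) * ν A) := by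
  have h := hX.2.1 A hA hν
  have hm : Measurable fun x : ℝ≥0∞ => expNeg (v * x) := by fun_prop
  have h1 : ∫⁻ ω, expNeg (v * pointMeasure X ω A) ∂P =
      ∫⁻ x, expNeg (v * x) ∂(P.map fun ω => pointMeasure X ω A) := by
    rw [lintegral_map hm (measurable_pointMeasure_apply hX.1 hA)]
  rw [h1]
  unfold pointMeasure
  rw [h, lintegral_map hm (measurable_of_countable _)]
  simp_rw [mul_comm v, expNeg_nat_mul]
  rw [lintegral_pow_poissonMeasure _ (expNeg_le_one v), ENNReal.coe_toNNReal hν]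

/-- The fibres of a simple function are disjoint, so their counts are independent Poisson variables
and the expectation factors. -/
lemma IsPoissonPoints.laplace_simpleFunc [IsProbabilityMeasure P] (hX : IsPoissonPoints P X ν)
    (F : SimpleFunc Plane ℝ≥0∞) (hF : ∀ v ≠ 0, ν (F ⁻¹' {v}) ≠ ∞) :
    ∫⁻ ω, expNeg (∫⁻ x, F x ∂(pointMeasure X ω)) ∂P =
      expNeg (∫⁻ x, (1 - expNeg (F x)) ∂ν) := by
  let e := F.range.equivFin
  let A : Fin F.range.card → Set Plane := fun j => F ⁻¹' {(e.symm j : ℝ≥0∞)}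
  have hA : ∀ j, MeasurableSet (A j) := fun j => F.measurableSet_fiber _
  have hd : Pairwise fun j l => Disjoint (A j) (A l) := by
    intro j l hjl
    refine Disjoint.preimage _ ?_
    rw [Set.disjoint_singleton]
    exact fun h => hjl (e.symm.injective (Subtype.ext h))
  have hind := hX.2.2 _ A hA hd
  have hsum : ∀ g : ℝ≥0∞ → ℝ≥0∞,
      ∑ v ∈ F.range, g v = ∑ j, g (e.symm j) := by
    intro g
    rw [← Finset.sum_coe_sort, ← e.symm.sum_comp]
  have h1 : ∀ ω, ∫⁻ x, F x ∂(pointMeasure X ω) =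
      ∑ j, (e.symm j : ℝ≥0∞) * pointMeasure X ω (A j) := by
    intro ω
    rw [SimpleFunc.lintegral_eq_lintegral, SimpleFunc.lintegral,
      hsum fun v => v * pointMeasure X ω (F ⁻¹' {v})]
  have h2 : ∫⁻ x, (1 - expNeg (F x)) ∂ν = ∑ j, (1 - expNeg (e.symm j)) * ν (A j) := by
    have := SimpleFunc.lintegral_eq_lintegral (F.map fun v => 1 - expNeg v) ν
    rw [SimpleFunc.map_lintegral, hsum fun v => (1 - expNeg v) * ν (F ⁻¹' {v})] at this
    exact this
  simp_rw [h1, h2, expNeg_sum]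
  rw [lintegral_prod_eq_prod_lintegral_of_indepFun Finset.univ
    (fun j ω => expNeg ((e.symm j : ℝ≥0∞) * pointMeasure X ω (A j)))]
  · refine Finset.prod_congr rfl fun j _ => ?_
    -- The fibre over 0 may have infinite intensity, but both of its factors equal 1.
    by_cases hv : (e.symm j : ℝ≥0∞) = 0
    · simp [hv, expNeg_zero]
    · exact hX.lintegral_expNeg_mul_apply (hA j) (hF _ hv) _
  · exact hind.comp (fun j x => expNeg ((e.symm j : ℝ≥0∞) * x)) fun j => by fun_prop
  · exact fun j => measurable_expNeg.comp
      ((measurable_pointMeasure_apply hX.1 (hA j)).const_mul _)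

/-- The Laplace functional of a Poisson point process. -/
theorem IsPoissonPoints.laplace_functional [IsProbabilityMeasure P] [SigmaFinite ν]
    (hX : IsPoissonPoints P X ν) {F : Plane → ℝ≥0∞} (hF : Measurable F) :
    ∫⁻ ω, expNeg (∑' i, F (X i ω)) ∂P = expNeg (∫⁻ x, (1 - expNeg (F x)) ∂ν) := by
  -- Cutting off to sets of finite intensity makes every fibre over a nonzero value finite, as the
  -- simple-function case requires.
  let G : ℕ → SimpleFunc Plane ℝ≥0∞ := fun n =>
    (SimpleFunc.eapprox F n).restrict (spanningSets ν n)
  have hGapp : ∀ n x, G n x = (spanningSets ν n).indicator (SimpleFunc.eapprox F n) x := by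
    intro n x
    rw [SimpleFunc.restrict_apply _ (measurableSet_spanningSets ν n)]
  have hGmono : ∀ x, Monotone fun n => G n x := by
    intro x m n hmn
    simp only [hGapp]
    refine (Set.indicator_le_indicator_of_subset (monotone_spanningSets ν hmn)
      (fun _ => bot_le) x).trans (Set.indicator_le_indicator ?_)
    exact SimpleFunc.monotone_eapprox F hmn x
  have hGlim : ∀ x, Tendsto (fun n => G n x) atTop (𝓝 (F x)) := by
    intro x
    refine (SimpleFunc.tendsto_eapprox hF x).congr' ?_
    filter_upwards [eventually_ge_atTop (spanningSetsIndex ν x)] with n hn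
    rw [hGapp, Set.indicator_of_mem]
    exact monotone_spanningSets ν hn (mem_spanningSetsIndex ν x)
  have hGint : ∀ μ : Measure Plane,
      Tendsto (fun n => ∫⁻ x, G n x ∂μ) atTop (𝓝 (∫⁻ x, F x ∂μ)) := fun μ =>
    lintegral_tendsto_of_tendsto_of_monotone (fun n => (G n).measurable.aemeasurable)
      (.of_forall hGmono) (.of_forall hGlim)
  have hGint' : Tendsto (fun n => ∫⁻ x, (1 - expNeg (G n x)) ∂ν) atTop
      (𝓝 (∫⁻ x, (1 - expNeg (F x)) ∂ν)) := by
    refine lintegral_tendsto_of_tendsto_of_monotone (fun n => ?_) (.of_forall fun x => ?_)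
      (.of_forall fun x => ?_)
    · exact (measurable_const.sub (measurable_expNeg.comp (G n).measurable)).aemeasurable
    · exact fun m n hmn => tsub_le_tsub_left (expNeg_antitone (hGmono x hmn)) _
    · exact ENNReal.Tendsto.sub tendsto_const_nhds ((continuous_expNeg.tendsto _).comp (hGlim x))
        (.inl ENNReal.one_ne_top)
  simp_rw [← lintegral_pointMeasure X _ hF]
  have hL : Tendsto (fun n => ∫⁻ ω, expNeg (∫⁻ x, G n x ∂(pointMeasure X ω)) ∂P) atTop
      (𝓝 (∫⁻ ω, expNeg (∫⁻ x, F x ∂(pointMeasure X ω)) ∂P)) := by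
    -- These integrands decrease in `n`, so the bound by 1 replaces monotone convergence.
    refine tendsto_lintegral_of_dominated_convergence (fun _ => 1) (fun n => ?_)
      (fun n => .of_forall fun ω => expNeg_le_one _) (by simp)
      (.of_forall fun ω => (continuous_expNeg.tendsto _).comp (hGint _))
    simp_rw [lintegral_pointMeasure X _ (G n).measurable]
    exact measurable_expNeg.comp
      (Measurable.tsum fun i => (G n).measurable.comp (hX.1 i))
  refine tendsto_nhds_unique hL (((continuous_expNeg.tendsto _).comp hGint').congr fun n => ?_)
  refine (hX.laplace_simpleFunc (G n) fun v hv => ?_).symm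
  refine ((measure_mono fun x hx => ?_).trans_lt (measure_spanningSets_lt_top ν n)).ne
  by_contra h
  rw [Set.mem_preimage, hGapp, Set.indicator_of_notMem h] at hx
  exact hv hx.symm

end LaplaceFunctional

/-! ### Independence of disjoint blocks of marks. -/

section Blocks

variable {Ω : Type*} [MeasurableSpace Ω] {P : Measure Ω} {ι κ : Type*} {f : ι → Ω → ℝ}
  {S : κ → Set ι} {Y : κ → Ω → ℝ≥0∞}

/-- Disjoint index sets of an independent family generate independent σ-algebras; the induction
separates one block from the union of the others. -/
lemma lintegral_prod_of_disjoint_blocks [IsProbabilityMeasure P]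
    (hf : iIndepFun f P) (hfm : ∀ i, Measurable (f i))
    (hS : Pairwise fun k l => Disjoint (S k) (S l))
    (hY : ∀ k, Measurable[⨆ i ∈ S k, MeasurableSpace.comap (f i) inferInstance] (Y k))
    (s : Finset κ) :
    ∫⁻ ω, ∏ k ∈ s, Y k ω ∂P = ∏ k ∈ s, ∫⁻ ω, Y k ω ∂P := by
  classical
  induction s using Finset.induction_on with
  | empty => simp
  | insert b s hb ih =>
    simp_rw [Finset.prod_insert hb]
    rw [← ih]
    have hle : ∀ T : Set ι,
        ⨆ i ∈ T, MeasurableSpace.comap (f i) inferInstance ≤ ‹MeasurableSpace Ω› :=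
      fun T => iSup₂_le fun i _ => (hfm i).comap_le
    have hdisj : Disjoint (S b) (⋃ k ∈ s, S k) := by
      simp only [Set.disjoint_iUnion_right]
      exact fun k hk => hS (fun h => hb (h ▸ hk))
    refine lintegral_mul_eq_lintegral_mul_lintegral_of_independent_measurableSpace (hle _) (hle _)
      (indep_iSup_of_disjoint (fun i => (hfm i).comap_le) hf.iIndep hdisj) (hY b) ?_
    refine Finset.measurable_fun_prod _ fun k hk => (hY k).mono ?_ le_rfl
    exact biSup_mono fun i hi => Set.mem_biUnion hk hi

/-- Both sides are limits of the same finite products. Writing the infinite product as `expNeg` of a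
sum of `negLog` puts it in the form that the Laplace functional accepts. -/
lemma lintegral_expNeg_tsum_of_disjoint_blocks [IsProbabilityMeasure P] [Countable κ]
    (hf : iIndepFun f P) (hfm : ∀ i, Measurable (f i))
    (hS : Pairwise fun k l => Disjoint (S k) (S l))
    (hY : ∀ k, Measurable[⨆ i ∈ S k, MeasurableSpace.comap (f i) inferInstance] (Y k)) :
    ∫⁻ ω, expNeg (∑' k, Y k ω) ∂P = expNeg (∑' k, negLog (∫⁻ ω, expNeg (Y k ω) ∂P)) := by
  have hYm : ∀ k, Measurable (Y k) := fun k =>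
    (hY k).mono (iSup₂_le fun i _ => (hfm i).comap_le) le_rfl
  have h1 : Tendsto (fun s : Finset κ => ∫⁻ ω, ∏ k ∈ s, expNeg (Y k ω) ∂P) atTop
      (𝓝 (∫⁻ ω, expNeg (∑' k, Y k ω) ∂P)) := by
    refine tendsto_lintegral_filter_of_dominated_convergence (fun _ => 1) (.of_forall fun s => ?_)
      (.of_forall fun s => .of_forall fun ω => ?_) (by simp)
      (.of_forall fun ω => tendsto_prod_expNeg _)
    · exact Finset.measurable_fun_prod _ fun k _ => measurable_expNeg.comp (hYm k)
    · exact Finset.prod_le_one' fun k _ => expNeg_le_one _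
  refine tendsto_nhds_unique h1 ((tendsto_prod_expNeg _).congr fun s => ?_)
  rw [lintegral_prod_of_disjoint_blocks (Y := fun k ω => expNeg (Y k ω)) hf hfm hS
    (fun k => measurable_expNeg.comp (hY k))]
  refine Finset.prod_congr rfl fun k _ => expNeg_negLog ?_
  calc ∫⁻ ω, expNeg (Y k ω) ∂P ≤ ∫⁻ _, 1 ∂P := lintegral_mono fun ω => expNeg_le_one _
    _ = 1 := by simp

end Blocks

/-! ### Tail and Laplace transform of exponential fading. -/

section Exponential

variable {Ω : Type*} [MeasurableSpace Ω] {P : Measure Ω} {h : Ω → ℝ}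

lemma expMeasure_Ici {a : ℝ} (ha : 0 ≤ a) :
    expMeasure 1 (Set.Ici a) = ENNReal.ofReal (Real.exp (-a)) := by
  have : IsProbabilityMeasure (expMeasure 1) := isProbabilityMeasure_expMeasure one_pos
  have : NullSingletonClass (expMeasure 1) :=
    ⟨fun x => withDensity_absolutelyContinuous _ _ (measure_singleton x)⟩
  have h1 : (expMeasure 1).real (Set.Iic a) = 1 - Real.exp (-a) := by
    rw [← cdf_eq_real, cdf_expMeasure_eq one_pos, if_pos ha, one_mul]
  have h2 : (expMeasure 1).real (Set.Ioi a) = Real.exp (-a) := by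
    rw [← Set.compl_Iic, probReal_compl_eq_one_sub measurableSet_Iic, h1]; ring
  rw [← measure_congr Ioi_ae_eq_Ici, ← h2, ofReal_measureReal]

lemma prob_le_ofReal_mul (hm : Measurable h) (hh : P.map h = expMeasure 1) (a : ℝ≥0∞) {b : ℝ}
    (hb : 0 < b) :
    P {ω | a ≤ ENNReal.ofReal (h ω * b)} = expNeg (a / ENNReal.ofReal b) := by
  have hP : P Set.univ = 1 := by
    have : IsProbabilityMeasure (expMeasure 1) := isProbabilityMeasure_expMeasure one_pos
    rw [← Set.preimage_univ (f := h), ← Measure.map_apply hm MeasurableSet.univ, hh, measure_univ]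
  by_cases ha : a = ∞
  · simp [ha, ENNReal.top_div, expNeg_top]
  by_cases ha0 : a = 0
  · simp [ha0, expNeg_zero, hP]
  have hpos : 0 < a.toReal := ENNReal.toReal_pos ha0 ha
  have h1 : {ω | a ≤ ENNReal.ofReal (h ω * b)} = h ⁻¹' (Set.Ici (a.toReal / b)) := by
    ext ω
    conv_lhs => rw [← ENNReal.ofReal_toReal ha]
    simp only [Set.mem_ofPred_eq, ENNReal.ofReal_le_ofReal_iff', Set.mem_preimage, Set.mem_Ici,
      div_le_iff₀ hb, not_le.2 hpos, or_false]
  rw [h1, ← Measure.map_apply hm measurableSet_Ici, hh, expMeasure_Ici (by positivity),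
    ← expNeg_ofReal (by positivity), ENNReal.ofReal_div_of_pos hb, ENNReal.ofReal_toReal ha]

/-- Tilting the unit exponential density by `exp (-b x)` gives `1 / (1 + b)` times the exponential
density of rate `1 + b`, whose mass is 1. -/
lemma lintegral_expNeg_ofReal_mul (hm : Measurable h) (hh : P.map h = expMeasure 1) {b : ℝ}
    (hb : 0 ≤ b) :
    ∫⁻ ω, expNeg (ENNReal.ofReal (h ω * b)) ∂P = ENNReal.ofReal (1 / (1 + b)) := by
  have hmb : Measurable fun x : ℝ => expNeg (ENNReal.ofReal (x * b)) := by fun_prop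
  have h1 : ∫⁻ ω, expNeg (ENNReal.ofReal (h ω * b)) ∂P =
      ∫⁻ x, expNeg (ENNReal.ofReal (x * b)) ∂(expMeasure 1) := by
    rw [← hh, lintegral_map hmb hm]
  have h2 : expMeasure 1 = volume.withDensity (exponentialPDF 1) := rfl
  have hpdf : ∀ r, Measurable (exponentialPDF r) := fun r =>
    (measurable_exponentialPDFReal r).ennreal_ofReal
  rw [h1, h2, lintegral_withDensity_eq_lintegral_mul _ (hpdf 1) hmb]
  have h3 : ∀ x, (exponentialPDF 1 * fun x => expNeg (ENNReal.ofReal (x * b))) x =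
      ENNReal.ofReal (1 / (1 + b)) * exponentialPDF (1 + b) x := by
    intro x
    rw [Pi.mul_apply]
    rcases lt_or_ge x 0 with hx | hx
    · rw [exponentialPDF_of_neg hx, exponentialPDF_of_neg hx, zero_mul, mul_zero]
    · rw [exponentialPDF_of_nonneg hx, exponentialPDF_of_nonneg hx, expNeg_ofReal (by positivity),
        ← ENNReal.ofReal_mul (by positivity), ← ENNReal.ofReal_mul (by positivity)]
      congr 1
      rw [← mul_assoc, one_div_mul_cancel (by positivity), one_mul, one_mul, one_mul,
        ← Real.exp_add]
      congr 1; ring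
  simp_rw [h3]
  rw [lintegral_const_mul _ (hpdf _), lintegral_exponentialPDF_eq_one (by positivity), mul_one]

end Exponential

/-! ### The distance to the nearest point. -/

section Nearest

variable {Ω : Type*} [MeasurableSpace Ω] {P : Measure Ω} {X : ℕ → Ω → Plane} {d : ℝ}

lemma measurable_iInf_norm (hX : ∀ i, Measurable (X i)) : Measurable fun ω => ⨅ i, ‖X i ω‖ :=
  Measurable.iInf fun i => (hX i).norm

lemma IsPoissonPoints.prob_le_nearest (hX : IsPoissonPoints P X (ENNReal.ofReal d • volume))
    (hd : 0 < d) {r : ℝ} (hr : 0 ≤ r) :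
    P {ω | r ≤ ⨅ i, ‖X i ω‖} = ENNReal.ofReal (Real.exp (-(d * Real.pi * r ^ 2))) := by
  have hA : MeasurableSet (Metric.ball (0 : Plane) r) := measurableSet_ball
  have hν : (ENNReal.ofReal d • (volume : Measure Plane)) (Metric.ball 0 r) =
      ENNReal.ofReal (d * Real.pi * r ^ 2) := by
    rw [Measure.smul_apply, EuclideanSpace.volume_ball_fin_two, smul_eq_mul,
      ← ENNReal.ofReal_pow hr, mul_assoc, ENNReal.ofReal_mul hd.le, mul_comm Real.pi,
      ENNReal.ofReal_mul (by positivity)]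
  -- At `v = ∞` the integrand is the indicator that the open ball contains no point.
  have h := hX.lintegral_expNeg_mul_apply hA (by rw [hν]; exact ENNReal.ofReal_ne_top) ∞
  rw [expNeg_top, tsub_zero, one_mul, hν, expNeg_ofReal (by positivity)] at h
  rw [← h, ← lintegral_indicator_one]
  · refine lintegral_congr fun ω => ?_
    have h1 : ω ∈ {ω | r ≤ ⨅ i, ‖X i ω‖} ↔ pointMeasure X ω (Metric.ball 0 r) = 0 := by
      rw [Set.mem_ofPred_eq, le_ciInf_iff ⟨0, by rintro _ ⟨i, rfl⟩; exact norm_nonneg _⟩,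
        pointMeasure, Measure.sum_apply _ hA, ENNReal.tsum_eq_zero]
      simp [Measure.dirac_apply' _ hA]
    by_cases h0 : pointMeasure X ω (Metric.ball 0 r) = 0
    · rw [Set.indicator_of_mem (h1.2 h0), h0, mul_zero, expNeg_zero, Pi.one_apply]
    · rw [Set.indicator_of_notMem (fun h' => h0 (h1.1 h')), ENNReal.top_mul h0, expNeg_top]
  · exact measurableSet_le measurable_const (measurable_iInf_norm hX.1)

/-- The density of the distance to the nearest point of a homogeneous Poisson point process. -/
noncomputable def nearestDensity (d r : ℝ) : ℝ :=
  Real.exp (-Real.pi * r ^ 2 * d) * (2 * Real.pi * r * d)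

lemma measurable_nearestDensity : Measurable (nearestDensity d) := by
  unfold nearestDensity; fun_prop

lemma lintegral_Ioi_nearestDensity (hd : 0 < d) {a : ℝ} (ha : 0 ≤ a) :
    ∫⁻ r in Set.Ioi a, ENNReal.ofReal (nearestDensity d r) =
      ENNReal.ofReal (Real.exp (-(d * Real.pi * a ^ 2))) := by
  let g : ℝ → ℝ := fun r => -Real.exp (-(d * Real.pi * r ^ 2))
  have hg : ∀ r, HasDerivAt g (nearestDensity d r) r := by
    intro r
    have h1 : HasDerivAt (fun r : ℝ => -(d * Real.pi * r ^ 2)) (-(d * Real.pi * (2 * r))) r := by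
      convert! ((hasDerivAt_pow 2 r).const_mul (d * Real.pi)).neg using 1
      simp
    refine h1.exp.neg.congr_deriv ?_
    rw [nearestDensity, show -Real.pi * r ^ 2 * d = -(d * Real.pi * r ^ 2) by ring]
    ring
  have hlim : Tendsto g atTop (𝓝 0) := by
    have : Tendsto (fun r : ℝ => d * Real.pi * r ^ 2) atTop atTop :=
      (tendsto_pow_atTop two_ne_zero).const_mul_atTop (by positivity)
    simpa [g] using (Real.tendsto_exp_neg_atTop_nhds_zero.comp this).neg
  have hpos : ∀ r ∈ Set.Ioi a, 0 ≤ nearestDensity d r := by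
    intro r hr
    have : 0 < r := ha.trans_lt hr
    unfold nearestDensity; positivity
  have hc : ContinuousWithinAt g (Set.Ici a) a := (hg a).continuousAt.continuousWithinAt
  rw [← ofReal_integral_eq_lintegral_ofReal
    (integrableOn_Ioi_deriv_of_nonneg hc (fun r _ => hg r) hpos hlim)
    ((ae_restrict_iff' measurableSet_Ioi).2 (.of_forall hpos)),
    integral_Ioi_of_hasDerivAt_of_nonneg hc (fun r _ => hg r) hpos hlim]
  simp [g]

/-- A finite measure on the line is determined by its values on the half-lines `[a, ∞)`, and these
are the void probabilities. -/
lemma IsPoissonPoints.map_nearest [IsProbabilityMeasure P]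
    (hX : IsPoissonPoints P X (ENNReal.ofReal d • volume)) (hd : 0 < d) :
    P.map (fun ω => ⨅ i, ‖X i ω‖) =
      (volume.restrict (Set.Ioi 0)).withDensity fun r => ENNReal.ofReal (nearestDensity d r) := by
  have hm := measurable_iInf_norm hX.1
  have : IsFiniteMeasure (P.map fun ω => ⨅ i, ‖X i ω‖) := by infer_instance
  refine Measure.ext_of_Ici _ _ fun a => ?_
  rw [Measure.map_apply hm measurableSet_Ici, withDensity_apply _ measurableSet_Ici,
    Measure.restrict_restrict measurableSet_Ici]
  rcases le_or_gt a 0 with ha | ha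
  · have h1 : (fun ω => ⨅ i, ‖X i ω‖) ⁻¹' Set.Ici a = {ω | 0 ≤ ⨅ i, ‖X i ω‖} := by
      ext ω
      have : 0 ≤ ⨅ i, ‖X i ω‖ := Real.iInf_nonneg fun i => norm_nonneg _
      simp [this, ha.trans this]
    rw [h1, hX.prob_le_nearest hd le_rfl, Set.inter_eq_right.2
      (Set.Ioi_subset_Ici ha), lintegral_Ioi_nearestDensity hd le_rfl]
  · rw [Set.inter_eq_left.2 (Set.Ici_subset_Ioi.2 ha),
      setLIntegral_congr Ioi_ae_eq_Ici.symm, lintegral_Ioi_nearestDensity hd ha.le]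
    exact hX.prob_le_nearest hd ha.le

/-- Needed because a negative real power takes the value 0 at 0, so the path loss is not decreasing
there. -/
lemma IsPoissonPoints.ae_nearest_pos [IsProbabilityMeasure P]
    (hX : IsPoissonPoints P X (ENNReal.ofReal d • volume)) (hd : 0 < d) :
    ∀ᵐ ω ∂P, 0 < ⨅ i, ‖X i ω‖ := by
  have hm := measurable_iInf_norm hX.1
  have : ∀ᵐ r ∂(P.map fun ω => ⨅ i, ‖X i ω‖), r ∈ Set.Ioi 0 := by
    rw [hX.map_nearest hd]
    exact (withDensity_absolutelyContinuous _ _).ae_le (ae_restrict_mem measurableSet_Ioi)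
  exact ae_of_ae_map hm.aemeasurable this

end Nearest

instance : Fintype Tier where
  elems := ⟨Multiset.ofList [.sbs, .mbs], by simp⟩
  complete := by rintro ⟨⟩ <;> simp

instance : DiscreteMeasurableSpace Path := ⟨fun _ => trivial⟩

instance : Countable Path :=
  Function.Injective.countable (f := fun t : Path => match t with | .los => 0 | .nlos => 1)
    (by rintro ⟨⟩ ⟨⟩ h <;> simp_all)

/-! ### Link probabilities, received powers and exclusion radii. -/

namespace Params

/-- The admissible ranges of the network parameters. -/
structure Valid (p : Params) : Prop where
  density_pos : ∀ k, 0 < p.density k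
  txPower_pos : ∀ k, 0 < p.txPower k
  bias_pos : ∀ k, 0 < p.bias k
  assocFading_pos : ∀ k, 0 < p.assocFading k
  gain_pos : ∀ t, 0 < p.gain t
  blockage_nonneg : 0 ≤ p.blockage
  noise_nonneg : 0 ≤ p.noise
  one_lt_exponent : ∀ t, 1 < p.exponent t
  two_lt_exponent_los : p.blockage = 0 → 2 < p.exponent .los
  two_lt_exponent_nlos : 2 < p.exponent .nlos

variable {p : Params}

namespace Valid

lemma pathProb_los_nonneg (hp : p.Valid) {r : ℝ} (hr : 0 ≤ r) : 0 ≤ p.pathProb .los r := by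
  have h1 : Real.exp (-p.blockage * r) ≤ 1 :=
    Real.exp_le_one_iff.2 (by nlinarith [mul_nonneg hp.blockage_nonneg hr])
  have h2 : 0 ≤ min (18 / r) 1 := le_min (by positivity) zero_le_one
  exact add_nonneg (mul_nonneg h2 (by linarith)) (Real.exp_pos _).le

lemma pathProb_los_le_one (hp : p.Valid) {r : ℝ} (hr : 0 ≤ r) : p.pathProb .los r ≤ 1 := by
  have h1 : Real.exp (-p.blockage * r) ≤ 1 :=
    Real.exp_le_one_iff.2 (by nlinarith [mul_nonneg hp.blockage_nonneg hr])
  have h2 : min (18 / r) 1 ≤ 1 := min_le_right _ _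
  have := mul_le_mul_of_nonneg_right h2 (sub_nonneg.2 h1)
  unfold pathProb
  linarith

lemma pathProb_nonneg (hp : p.Valid) (t : Path) {r : ℝ} (hr : 0 ≤ r) : 0 ≤ p.pathProb t r := by
  cases t
  · exact hp.pathProb_los_nonneg hr
  · exact sub_nonneg.2 (hp.pathProb_los_le_one hr)

lemma pathProb_le_one (hp : p.Valid) (t : Path) {r : ℝ} (hr : 0 ≤ r) : p.pathProb t r ≤ 1 := by
  cases t
  · exact hp.pathProb_los_le_one hr
  · exact sub_le_self _ (hp.pathProb_los_nonneg hr)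

lemma rxPower_nonneg (hp : p.Valid) (k : Tier) (t : Path) {r : ℝ} (hr : 0 ≤ r) :
    0 ≤ p.rxPower k t r :=
  mul_nonneg (mul_pos (hp.txPower_pos k) (hp.bias_pos k)).le
    (mul_nonneg (hp.gain_pos t).le (Real.rpow_nonneg hr _))

lemma rxPower_pos (hp : p.Valid) (k : Tier) (t : Path) {r : ℝ} (hr : 0 < r) :
    0 < p.rxPower k t r :=
  mul_pos (mul_pos (hp.txPower_pos k) (hp.bias_pos k))
    (mul_pos (hp.gain_pos t) (Real.rpow_pos_of_pos hr _))

lemma exclusion_pos (hp : p.Valid) (t : Path) (k : Tier) (u : Path) {r : ℝ} (hr : 0 < r) :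
    0 < p.exclusion t k u r := by
  have := hp.txPower_pos
  have := hp.bias_pos
  have := hp.assocFading_pos
  have := hp.gain_pos
  exact mul_pos (Real.rpow_pos_of_pos (div_pos (by simp [*]) (by simp [*])) _)
    (Real.rpow_pos_of_pos hr _)

lemma assocPower_exclusion (hp : p.Valid) (t : Path) (k : Tier) (u : Path) {r : ℝ} (hr : 0 < r) :
    p.assocPower k u (p.exclusion t k u r) = p.assocPower .mbs t r := by
  have h1 := hp.txPower_pos
  have h2 := hp.bias_pos
  have h3 := hp.assocFading_pos
  have h4 := hp.gain_pos
  have hu : p.exponent u ≠ 0 := (zero_lt_one.trans (hp.one_lt_exponent u)).ne'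
  have ha : 0 < p.txPower k * p.bias k * p.assocFading k * p.gain u := by simp [*]
  have hb : 0 < p.txPower .mbs * p.bias .mbs * p.assocFading .mbs * p.gain t := by simp [*]
  have h5 : p.exclusion t k u r ^ (-p.exponent u) =
      ((p.txPower .mbs * p.bias .mbs * p.assocFading .mbs * p.gain t) /
        (p.txPower k * p.bias k * p.assocFading k * p.gain u)) * r ^ (-p.exponent t) := by
    rw [exclusion, Real.mul_rpow (Real.rpow_nonneg (div_pos hb ha).le _) (Real.rpow_nonneg hr.le _),
      ← Real.rpow_mul (div_pos hb ha).le, ← Real.rpow_mul hr.le]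
    rw [show -1 / p.exponent u * -p.exponent u = 1 by field_simp,
      show p.exponent t / p.exponent u * -p.exponent u = -p.exponent t by field_simp, Real.rpow_one]
  simp only [assocPower, rxPower, pathLoss, h5]
  have := (h1 k).ne'
  have := (h2 k).ne'
  have := (h3 k).ne'
  have := (h4 u).ne'
  field_simp

/-- Power is strictly decreasing in positive distance, and at the exclusion radius the two powers
agree. -/
lemma assocPower_le_iff (hp : p.Valid) (t : Path) (k : Tier) (u : Path) {d r : ℝ} (hd : 0 < d)
    (hr : 0 < r) :
    p.assocPower k u d ≤ p.assocPower .mbs t r ↔ p.exclusion t k u r ≤ d := by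
  rw [← hp.assocPower_exclusion t k u hr]
  simp only [assocPower, rxPower, pathLoss]
  rw [mul_le_mul_iff_right₀ (hp.assocFading_pos k),
    mul_le_mul_iff_right₀ (mul_pos (hp.txPower_pos k) (hp.bias_pos k)),
    mul_le_mul_iff_right₀ (hp.gain_pos u),
    Real.rpow_le_rpow_iff_of_neg hd (hp.exclusion_pos t k u hr)
      (neg_neg_of_pos (zero_lt_one.trans (hp.one_lt_exponent u)))]

end Valid

@[fun_prop]
lemma measurable_pathProb (p : Params) (t : Path) : Measurable (p.pathProb t) := by
  cases t <;> · unfold pathProb; fun_prop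

@[fun_prop]
lemma measurable_rxPower (p : Params) (k : Tier) (t : Path) : Measurable (p.rxPower k t) := by
  unfold rxPower pathLoss; fun_prop

@[fun_prop]
lemma measurable_assocPower (p : Params) (k : Tier) (t : Path) :
    Measurable (p.assocPower k t) := by
  unfold assocPower; fun_prop

@[fun_prop]
lemma measurable_exclusion (p : Params) (t : Path) (k : Tier) (u : Path) :
    Measurable (p.exclusion t k u) := by
  unfold exclusion; fun_prop

lemma measurable_assocDensity (p : Params) (t : Path) : Measurable (p.assocDensity t) := by
  unfold assocDensity; fun_prop

lemma Valid.assocDensity_nonneg {p : Params} (hp : p.Valid) (t : Path) {r : ℝ} (hr : 0 ≤ r) :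
    0 ≤ p.assocDensity t r := by
  have := hp.pathProb_nonneg t hr
  have := hp.density_pos .mbs
  unfold assocDensity
  positivity

end Params

/-! ### The association law and its density. -/

section AssociationLaw

variable {Ω : Type*} [MeasurableSpace Ω] {P : Measure Ω} [IsProbabilityMeasure P] {p : Params}
  {N : Network Ω}

lemma Network.IsModel.beatProb_eq (hN : N.IsModel p P) (hp : p.Valid) (t : Path) (k : Tier)
    (u : Path) {r : ℝ} (hr : 0 < r) :
    N.beatProb p P t k u r = Real.exp (-p.density k * Real.pi * p.exclusion t k u r ^ 2) := by
  have h1 := (hN.poisson k).prob_le_nearest (hp.density_pos k) (hp.exclusion_pos t k u hr).le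
  have h2 : {ω | p.assocPower k u (N.nearest k ω) ≤ p.assocPower .mbs t r} =ᵐ[P]
      {ω | p.exclusion t k u r ≤ ⨅ i, ‖N.pos k i ω‖} := by
    filter_upwards [(hN.poisson k).ae_nearest_pos (hp.density_pos k)] with ω hω
    exact propext (hp.assocPower_le_iff t k u hω hr)
  rw [Network.beatProb, measureReal_congr h2, measureReal_def, h1,
    ENNReal.toReal_ofReal (Real.exp_pos _).le]
  congr 1; ring

lemma Network.IsModel.assocLaw_eq (hN : N.IsModel p P) (hp : p.Valid) (t : Path) :
    N.assocLaw p P t = (volume.restrict (Set.Ioi 0)).withDensity fun r =>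
      ENNReal.ofReal (p.assocDensity t r) := by
  have hmap : P.map (N.nearest .mbs) = (volume.restrict (Set.Ioi 0)).withDensity fun r =>
      ENNReal.ofReal (nearestDensity (p.density .mbs) r) :=
    (hN.poisson .mbs).map_nearest (hp.density_pos .mbs)
  let w : ℝ → ℝ := fun r =>
    Real.exp (-p.density .mbs * Real.pi * p.exclusion t .mbs t.other r ^ 2) *
    Real.exp (-p.density .sbs * Real.pi * p.exclusion t .sbs .los r ^ 2) *
    Real.exp (-p.density .sbs * Real.pi * p.exclusion t .sbs .nlos r ^ 2) * p.pathProb t r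
  have hw : Measurable w := by fun_prop
  have h1 : (fun r => ENNReal.ofReal (N.beatProb p P t .mbs t.other r *
      N.beatProb p P t .sbs .los r * N.beatProb p P t .sbs .nlos r * p.pathProb t r))
      =ᵐ[P.map (N.nearest .mbs)] fun r => ENNReal.ofReal (w r) := by
    rw [hmap]
    refine (withDensity_absolutelyContinuous _ _).ae_le ?_
    filter_upwards [ae_restrict_mem measurableSet_Ioi] with r hr
    simp only [w, hN.beatProb_eq hp _ _ _ hr]
  rw [Network.assocLaw, withDensity_congr_ae h1, hmap,
    ← withDensity_mul _ measurable_nearestDensity.ennreal_ofReal hw.ennreal_ofReal]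
  refine withDensity_congr_ae ?_
  filter_upwards [ae_restrict_mem measurableSet_Ioi] with r (hr : 0 < r)
  have hn : 0 ≤ nearestDensity (p.density .mbs) r := by
    have := hp.density_pos .mbs
    unfold nearestDensity; positivity
  rw [Pi.mul_apply, ← ENNReal.ofReal_mul hn]
  congr 1
  simp only [w, nearestDensity, Params.assocDensity]
  ring

/-- The association density is the nearest-point density times factors at most 1. Finiteness is used
for the product measures and the additivity of `tierCoverage`. -/
lemma Network.IsModel.isFiniteMeasure_assocLaw (hN : N.IsModel p P) (hp : p.Valid) (t : Path) :
    IsFiniteMeasure (N.assocLaw p P t) := by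
  rw [hN.assocLaw_eq hp t]
  refine isFiniteMeasure_withDensity ?_
  have h1 : ∫⁻ r in Set.Ioi 0, ENNReal.ofReal (p.assocDensity t r) ≤
      ∫⁻ r in Set.Ioi 0, ENNReal.ofReal (nearestDensity (p.density .mbs) r) := by
    refine setLIntegral_mono measurable_nearestDensity.ennreal_ofReal fun r (hr : 0 < r) => ?_
    refine ENNReal.ofReal_le_ofReal ?_
    have h0 := hp.density_pos
    have hle : ∀ k u, Real.exp (-p.density k * Real.pi * p.exclusion t k u r ^ 2) ≤ 1 := by
      intro k u
      rw [Real.exp_le_one_iff, neg_mul, neg_mul, neg_nonpos]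
      have := h0 k
      positivity
    have h2 : Real.exp (-p.density .mbs * Real.pi * p.exclusion t .mbs t.other r ^ 2) *
        Real.exp (-p.density .sbs * Real.pi * p.exclusion t .sbs .los r ^ 2) *
        Real.exp (-p.density .sbs * Real.pi * p.exclusion t .sbs .nlos r ^ 2) *
        p.pathProb t r ≤ 1 :=
      mul_le_one₀ (mul_le_one₀ (mul_le_one₀ (hle _ _) (Real.exp_pos _).le (hle _ _))
        (Real.exp_pos _).le (hle _ _)) (hp.pathProb_nonneg t hr.le) (hp.pathProb_le_one t hr.le)
    have hn : 0 ≤ nearestDensity (p.density .mbs) r := by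
      have := h0 .mbs
      unfold nearestDensity; positivity
    calc p.assocDensity t r = _ * nearestDensity (p.density .mbs) r := by
          rw [Params.assocDensity, nearestDensity]; ring
      _ ≤ nearestDensity (p.density .mbs) r := mul_le_of_le_one_left hn h2
  rw [lintegral_Ioi_nearestDensity (hp.density_pos .mbs) le_rfl] at h1
  exact ne_top_of_le_ne_top ENNReal.ofReal_ne_top h1

end AssociationLaw

/-! ### Conditioning on one of two independent variables. -/

section Independence

variable {Ω α β : Type*} [MeasurableSpace Ω] [MeasurableSpace α] [MeasurableSpace β]
  {P : Measure Ω} [IsProbabilityMeasure P] {Z : Ω → α} {W : Ω → β}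

lemma measure_mem_eq_lintegral_of_indepFun (h : IndepFun Z W P) (hZ : Measurable Z)
    (hW : Measurable W) {B : Set (α × β)} (hB : MeasurableSet B) :
    P {ω | (Z ω, W ω) ∈ B} = ∫⁻ ω, P {ω' | (Z ω, W ω') ∈ B} ∂P := by
  have h1 := (indepFun_iff_map_prod_eq_prod_map_map hZ.aemeasurable hW.aemeasurable).1 h
  have : IsProbabilityMeasure (P.map W) := Measure.isProbabilityMeasure_map hW.aemeasurable
  have h2 : P {ω | (Z ω, W ω) ∈ B} = P.map (fun ω => (Z ω, W ω)) B := by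
    rw [Measure.map_apply (hZ.prodMk hW) hB]; rfl
  rw [h2, h1, Measure.prod_apply hB, lintegral_map (measurable_measure_prodMk_left hB) hZ]
  refine lintegral_congr fun ω => ?_
  rw [Measure.map_apply hW (measurable_prodMk_left hB)]
  rfl

end Independence

lemma sum_tier {M : Type*} [AddCommMonoid M] (f : Tier → M) : ∑ k, f k = f .sbs + f .mbs := by
  simp [Finset.sum, Finset.univ, Fintype.elems]

lemma prod_tier {M : Type*} [CommMonoid M] (f : Tier → M) : ∏ k, f k = f .sbs * f .mbs := by
  simp [Finset.prod, Finset.univ, Fintype.elems]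

lemma measurable_tsum_ennreal {α ι : Type*} [Countable ι] {m : MeasurableSpace α}
    {f : ι → α → ℝ≥0∞} (hf : ∀ i, Measurable[m] (f i)) :
    Measurable[m] fun a => ∑' i, f i a :=
  Measurable.tsum hf

/-- Index set of the marks: the serving link, the obstacles and the interfering links. -/
abbrev MarkIndex : Type := Unit ⊕ ((Tier × ℕ) ⊕ (Tier × ℕ))

/-! ### Power and Laplace loss of a single BS. -/

namespace Params

open Classical in
/-- Interference from a BS of tier `k` over a link of type `u`, length `d` and fading `h`. -/
noncomputable def linkPower (p : Params) (t : Path) (r : ℝ) (k : Tier) (u : Path) (d h : ℝ) :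
    ℝ≥0∞ :=
  if p.assocPower k u d ≤ p.assocPower .mbs t r then ENNReal.ofReal (h * p.rxPower k u d) else 0

/-- Interference from a BS of tier `k` at distance `d` with obstacle variable `o` and
fading `h`. -/
noncomputable def bsPower (p : Params) (t : Path) (r : ℝ) (k : Tier) (d o h : ℝ) : ℝ≥0∞ :=
  if o ≤ p.pathProb .los d then p.linkPower t r k .los d h else p.linkPower t r k .nlos d h

/-- Interference as a function of the positions and the marks. -/
noncomputable def sumPower (p : Params) (t : Path) (r : ℝ) (x : Tier → ℕ → Plane)
    (m : MarkIndex → ℝ) : ℝ≥0∞ :=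
  ∑' a : Tier × ℕ, p.bsPower t r a.1 ‖x a.1 a.2‖ (m (.inr (.inl a))) (m (.inr (.inr a)))

open Classical in
/-- `1` minus the Laplace transform at `θ` of `linkPower`, for unit-mean exponential fading. -/
noncomputable def linkLoss (p : Params) (t : Path) (θ r : ℝ) (k : Tier) (u : Path) (d : ℝ) : ℝ :=
  if p.assocPower k u d ≤ p.assocPower .mbs t r then
    θ * p.rxPower k u d / (1 + θ * p.rxPower k u d) else 0

/-- `1` minus the Laplace transform at `θ` of `bsPower`. -/
noncomputable def bsLoss (p : Params) (t : Path) (θ r : ℝ) (k : Tier) (d : ℝ) : ℝ :=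
  p.pathProb .los d * p.linkLoss t θ r k .los d + p.pathProb .nlos d * p.linkLoss t θ r k .nlos d

variable (p : Params) (t : Path) (k : Tier)

lemma measurable_linkPower (u : Path) :
    Measurable fun z : ℝ × ℝ × ℝ => p.linkPower t z.1 k u z.2.1 z.2.2 := by
  unfold linkPower
  refine Measurable.ite (measurableSet_le ?_ ?_) ?_ measurable_const <;> fun_prop

lemma measurable_bsPower :
    Measurable fun z : ℝ × ℝ × ℝ × ℝ => p.bsPower t z.1 k z.2.1 z.2.2.1 z.2.2.2 := by
  unfold bsPower
  refine Measurable.ite (measurableSet_le (by fun_prop) (by fun_prop)) ?_ ?_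
  · exact (p.measurable_linkPower t k .los).comp
      (f := fun z : ℝ × ℝ × ℝ × ℝ => (z.1, z.2.1, z.2.2.2)) (by fun_prop)
  · exact (p.measurable_linkPower t k .nlos).comp
      (f := fun z : ℝ × ℝ × ℝ × ℝ => (z.1, z.2.1, z.2.2.2)) (by fun_prop)

lemma measurable_linkLoss (θ r : ℝ) (u : Path) : Measurable (p.linkLoss t θ r k u) := by
  unfold linkLoss
  refine Measurable.ite (measurableSet_le ?_ ?_) ?_ measurable_const <;> fun_prop

lemma measurable_bsLoss (θ r : ℝ) : Measurable (p.bsLoss t θ r k) := by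
  have := p.measurable_linkLoss t k θ r
  unfold bsLoss
  fun_prop

variable {p} {θ r : ℝ}

lemma Valid.linkLoss_nonneg (hp : p.Valid) (hθ : 0 ≤ θ) (u : Path) {d : ℝ} (hd : 0 ≤ d) :
    0 ≤ p.linkLoss t θ r k u d := by
  have := hp.rxPower_nonneg k u hd
  unfold linkLoss
  split_ifs <;> positivity

lemma Valid.linkLoss_le_one (hp : p.Valid) (hθ : 0 ≤ θ) (u : Path) {d : ℝ} (hd : 0 ≤ d) :
    p.linkLoss t θ r k u d ≤ 1 := by
  have := hp.rxPower_nonneg k u hd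
  unfold linkLoss
  split_ifs
  · exact div_le_one_of_le₀ (by linarith) (by positivity)
  · exact zero_le_one

lemma Valid.bsLoss_nonneg (hp : p.Valid) (hθ : 0 ≤ θ) {d : ℝ} (hd : 0 ≤ d) :
    0 ≤ p.bsLoss t θ r k d :=
  add_nonneg
    (mul_nonneg (hp.pathProb_nonneg _ hd) (hp.linkLoss_nonneg t k hθ _ hd))
    (mul_nonneg (hp.pathProb_nonneg _ hd) (hp.linkLoss_nonneg t k hθ _ hd))

lemma Valid.bsLoss_le_one (hp : p.Valid) (hθ : 0 ≤ θ) {d : ℝ} (hd : 0 ≤ d) :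
    p.bsLoss t θ r k d ≤ 1 := by
  have h1 := mul_le_of_le_one_right (hp.pathProb_nonneg .los hd)
    (hp.linkLoss_le_one t k hθ (r := r) .los hd)
  have h2 := mul_le_of_le_one_right (hp.pathProb_nonneg .nlos hd)
    (hp.linkLoss_le_one t k hθ (r := r) .nlos hd)
  have h3 : p.pathProb .los d + p.pathProb .nlos d = 1 := add_sub_cancel _ _
  unfold bsLoss
  linarith

section Marks

variable {Ω : Type*} [MeasurableSpace Ω] {P : Measure Ω} [IsProbabilityMeasure P] {o h : Ω → ℝ}

lemma Valid.lintegral_expNeg_linkPower (hp : p.Valid) (hθ : 0 ≤ θ) (u : Path) {d : ℝ} (hd : 0 ≤ d)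
    (hm : Measurable h) (hh : P.map h = expMeasure 1) :
    ∫⁻ ω, expNeg (ENNReal.ofReal θ * p.linkPower t r k u d (h ω)) ∂P =
      ENNReal.ofReal (1 - p.linkLoss t θ r k u d) := by
  have hrx := hp.rxPower_nonneg k u hd
  unfold linkPower linkLoss
  split_ifs
  · have h1 : ∀ ω, ENNReal.ofReal θ * ENNReal.ofReal (h ω * p.rxPower k u d) =
        ENNReal.ofReal (h ω * (θ * p.rxPower k u d)) := by
      intro ω
      rw [← ENNReal.ofReal_mul hθ]
      congr 1; ring
    simp_rw [h1]
    rw [lintegral_expNeg_ofReal_mul hm hh (by positivity)]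
    congr 1
    have : 1 + θ * p.rxPower k u d ≠ 0 := by positivity
    field_simp
    ring
  · simp [expNeg_zero]

/-- The uniform obstacle variable falls below the LoS probability with exactly that probability;
being independent of the fading, it mixes the two link transforms. -/
lemma Valid.lintegral_expNeg_bsPower (hp : p.Valid) (hθ : 0 ≤ θ) {d : ℝ} (hd : 0 ≤ d)
    (hom : Measurable o) (ho : P.map o = volume.restrict (Set.Icc (0 : ℝ) 1))
    (hm : Measurable h) (hh : P.map h = expMeasure 1) (hind : IndepFun o h P) :
    ∫⁻ ω, expNeg (ENNReal.ofReal θ * p.bsPower t r k d (o ω) (h ω)) ∂P =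
      ENNReal.ofReal (1 - p.bsLoss t θ r k d) := by
  set a := p.pathProb .los d with ha
  have ha0 : 0 ≤ a := hp.pathProb_nonneg .los hd
  have ha1 : a ≤ 1 := hp.pathProb_le_one .los hd
  let q : Path → ℝ → ℝ≥0∞ := fun u y => expNeg (ENNReal.ofReal θ * p.linkPower t r k u d y)
  have hq : ∀ u, Measurable (q u) := by
    intro u
    exact measurable_expNeg.comp (((p.measurable_linkPower t k u).comp
      (f := fun y : ℝ => (r, d, y)) (by fun_prop)).const_mul _)
  have hsplit : ∀ ω, expNeg (ENNReal.ofReal θ * p.bsPower t r k d (o ω) (h ω)) =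
      (Set.Iic a).indicator 1 (o ω) * q .los (h ω) +
        (Set.Ioi a).indicator 1 (o ω) * q .nlos (h ω) := by
    intro ω
    rcases le_or_gt (o ω) a with hoa | hoa
    · rw [bsPower, if_pos hoa, Set.indicator_of_mem (Set.mem_Iic.2 hoa),
        Set.indicator_of_notMem (by simpa using hoa)]
      simp [q]
    · rw [bsPower, if_neg (not_le.2 hoa), Set.indicator_of_notMem (by simpa using hoa),
        Set.indicator_of_mem (Set.mem_Ioi.2 hoa)]
      simp [q]
  have hprod : ∀ (s : Set ℝ), MeasurableSet s → ∀ u,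
      ∫⁻ ω, s.indicator (1 : ℝ → ℝ≥0∞) (o ω) * q u (h ω) ∂P =
        volume (s ∩ Set.Icc 0 1) * ENNReal.ofReal (1 - p.linkLoss t θ r k u d) := by
    intro s hs u
    have hi : Measurable (s.indicator (1 : ℝ → ℝ≥0∞)) := measurable_one.indicator hs
    refine (lintegral_mul_eq_lintegral_mul_lintegral_of_indepFun'' (hi.comp hom).aemeasurable
      ((hq u).comp hm).aemeasurable (hind.comp hi (hq u))).trans ?_
    refine congrArg₂ _ ?_ (hp.lintegral_expNeg_linkPower t k hθ u hd hm hh)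
    change ∫⁻ ω, s.indicator (1 : ℝ → ℝ≥0∞) (o ω) ∂P = _
    rw [← lintegral_map hi hom, ho, lintegral_indicator_one hs, Measure.restrict_apply hs]
  simp_rw [hsplit]
  rw [lintegral_add_left, hprod _ measurableSet_Iic, hprod _ measurableSet_Ioi]
  · have h1 : Set.Iic a ∩ Set.Icc 0 1 = Set.Icc 0 a := by
      ext y; simp only [Set.mem_inter_iff, Set.mem_Iic, Set.mem_Icc]
      constructor
      · rintro ⟨h1, h2, h3⟩; exact ⟨h2, h1⟩
      · rintro ⟨h1, h2⟩; exact ⟨h2, h1, h2.trans ha1⟩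
    have h2 : Set.Ioi a ∩ Set.Icc 0 1 = Set.Ioc a 1 := by
      ext y; simp only [Set.mem_inter_iff, Set.mem_Ioi, Set.mem_Icc, Set.mem_Ioc]
      constructor
      · rintro ⟨h1, h2, h3⟩; exact ⟨h1, h3⟩
      · rintro ⟨h1, h2⟩; exact ⟨h1, ha0.trans h1.le, h2⟩
    have h3 := sub_nonneg.2 (hp.linkLoss_le_one t k (r := r) hθ .los hd)
    have h4 := sub_nonneg.2 (hp.linkLoss_le_one t k (r := r) hθ .nlos hd)
    have h5 : p.pathProb .nlos d = 1 - a := rfl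
    rw [h1, h2, Real.volume_Icc, Real.volume_Ioc, sub_zero, ← ENNReal.ofReal_mul ha0,
      ← ENNReal.ofReal_mul (sub_nonneg.2 ha1), ← ENNReal.ofReal_add (mul_nonneg ha0 h3)
      (mul_nonneg (sub_nonneg.2 ha1) h4)]
    congr 1
    rw [bsLoss, h5, ← ha]
    ring
  · exact ((measurable_one.indicator measurableSet_Iic).comp hom).mul ((hq .los).comp hm)

end Marks

end Params

/-! ### Coverage probability for a fixed serving link. -/

section Coverage

lemma Network.interference_add {Ω : Type*} (N : Network Ω) (p : Params) (t : Path) (r : ℝ) (ω : Ω) :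
    N.interference p .sbs t r ω + N.interference p .mbs t r ω =
      p.sumPower t r (fun k i => N.pos k i ω) (fun j => N.mark j ω) := by
  have h1 : ∀ k, N.interference p k t r ω =
      ∑' i, p.bsPower t r k ‖N.pos k i ω‖ (N.obstacle k i ω) (N.fading k i ω) := by
    intro k
    refine tsum_congr fun i => ?_
    by_cases h : N.obstacle k i ω ≤ p.pathProb .los ‖N.pos k i ω‖
    · simp [Network.linkPath, Params.bsPower, Params.linkPower, h]
    · simp [Network.linkPath, Params.bsPower, Params.linkPower, h]
  rw [Params.sumPower, ENNReal.tsum_prod', tsum_fintype, sum_tier, h1, h1]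
  rfl

variable {Ω : Type*} [MeasurableSpace Ω] {P : Measure Ω} {p : Params} {N : Network Ω}

lemma measurable_sumPower (p : Params) (t : Path) :
    Measurable fun z : ℝ × (Tier → ℕ → Plane) × (MarkIndex → ℝ) =>
      p.sumPower t z.1 z.2.1 z.2.2 := by
  refine Measurable.tsum fun a => ?_
  exact (p.measurable_bsPower t a.1).comp
    (f := fun z : ℝ × (Tier → ℕ → Plane) × (MarkIndex → ℝ) =>
      (z.1, ‖z.2.1 a.1 a.2‖, z.2.2 (.inr (.inl a)), z.2.2 (.inr (.inr a)))) (by fun_prop)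

lemma Network.IsModel.measurable_pos (hN : N.IsModel p P) :
    Measurable fun (ω : Ω) (k : Tier) (i : ℕ) => N.pos k i ω :=
  measurable_pi_lambda _ fun k => measurable_pi_lambda _ fun i => (hN.poisson k).1 i

lemma Network.IsModel.measurable_marks (hN : N.IsModel p P) :
    Measurable fun (ω : Ω) (j : MarkIndex) => N.mark j ω :=
  measurable_pi_lambda _ fun j => hN.measurable_mark j

/-- Joint measurability in length and outcome makes the coverage event measurable for the product
with the association law. -/
lemma Network.IsModel.measurable_sinr (hN : N.IsModel p P) (t : Path) :
    Measurable fun z : ℝ × Ω => N.sinr p t z.1 z.2 := by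
  have hs : Measurable N.servingFading := hN.measurable_mark (.inl ())
  unfold Network.sinr
  simp_rw [N.interference_add]
  refine Measurable.div (by fun_prop) (Measurable.add_const ?_ _)
  exact (measurable_sumPower p t).comp (measurable_fst.prodMk
    ((hN.measurable_pos.comp measurable_snd).prodMk (hN.measurable_marks.comp measurable_snd)))

/-- The indices of the obstacle and the fading of an interfering link. -/
def blockSet (a : Tier × ℕ) : Set MarkIndex := {.inr (.inl a), .inr (.inr a)}

variable [IsProbabilityMeasure P]

/-- The coverage probability when the positions of the BSs are given. -/
lemma Network.IsModel.prob_marks (hN : N.IsModel p P) (hp : p.Valid) (t : Path) {γ r : ℝ}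
    (hγ : 0 ≤ γ) (hr : 0 < r) (x : Tier → ℕ → Plane) :
    P {ω | ENNReal.ofReal γ * (p.sumPower t r x (fun j => N.mark j ω) + ENNReal.ofReal p.noise) ≤
        ENNReal.ofReal (N.servingFading ω * p.rxPower .mbs t r)} =
      expNeg (ENNReal.ofReal (γ * p.noise / p.rxPower .mbs t r)) *
        expNeg (∑' a : Tier × ℕ, negLog (ENNReal.ofReal
          (1 - p.bsLoss t (γ / p.rxPower .mbs t r) r a.1 ‖x a.1 a.2‖))) := by
  set S := p.rxPower .mbs t r with hS
  have hSpos : 0 < S := hp.rxPower_pos _ _ hr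
  have hθ : 0 ≤ γ / S := by positivity
  let Y : Tier × ℕ → Ω → ℝ≥0∞ := fun a ω =>
    p.bsPower t r a.1 ‖x a.1 a.2‖ (N.obstacle a.1 a.2 ω) (N.fading a.1 a.2 ω)
  let m : MarkIndex → MeasurableSpace Ω := fun j => MeasurableSpace.comap (N.mark j) inferInstance
  have hm : ∀ j, m j ≤ ‹MeasurableSpace Ω› := fun j => (hN.measurable_mark j).comap_le
  have hYm : ∀ a, Measurable[⨆ i ∈ blockSet a, m i] (Y a) := by
    intro a
    have h1 : Measurable[⨆ i ∈ blockSet a, m i] (N.obstacle a.1 a.2) :=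
      (comap_measurable (N.mark (.inr (.inl a)))).mono
        (le_iSup₂_of_le (f := fun i (_ : i ∈ blockSet a) => m i) (.inr (.inl a))
          (by simp [blockSet]) le_rfl) le_rfl
    have h2 : Measurable[⨆ i ∈ blockSet a, m i] (N.fading a.1 a.2) :=
      (comap_measurable (N.mark (.inr (.inr a)))).mono
        (le_iSup₂_of_le (f := fun i (_ : i ∈ blockSet a) => m i) (.inr (.inr a))
          (by simp [blockSet]) le_rfl) le_rfl
    exact (p.measurable_bsPower t a.1).comp
      (measurable_const.prodMk (measurable_const.prodMk (h1.prodMk h2)))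
  have hYm' : ∀ a, Measurable (Y a) := fun a =>
    (hYm a).mono (iSup₂_le fun i _ => hm i) le_rfl
  let T : Set MarkIndex := {.inl ()}
  have hsum : Measurable[⨆ i ∈ Tᶜ, m i] fun ω => ∑' a, Y a ω := by
    refine measurable_tsum_ennreal fun a => (hYm a).mono (biSup_mono fun i hi => ?_) le_rfl
    rcases hi with rfl | rfl <;> simp [T]
  have hsum' : Measurable fun ω => ∑' a, Y a ω := Measurable.tsum hYm'
  have hserv : Measurable N.servingFading := hN.measurable_mark (.inl ())
  have hind : IndepFun (fun ω => ∑' a, Y a ω) N.servingFading P := by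
    rw [IndepFun_iff_Indep]
    refine indep_of_indep_of_le_left (indep_of_indep_of_le_right
      (indep_iSup_of_disjoint hm hN.indep_marks.iIndep (disjoint_compl_left (a := T))) ?_) ?_
    · exact le_iSup₂_of_le (f := fun i (_ : i ∈ T) => m i) (.inl ()) rfl le_rfl
    · exact hsum.comap_le
  let B : Set (ℝ≥0∞ × ℝ) := {z | ENNReal.ofReal γ * (z.1 + ENNReal.ofReal p.noise) ≤
    ENNReal.ofReal (z.2 * S)}
  have hB : MeasurableSet B := measurableSet_le (by fun_prop) (by fun_prop)
  -- Freeze the interference; the inner probability is then an exponential tail of the serving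
  -- fading.
  have h1 := measure_mem_eq_lintegral_of_indepFun hind hsum' hserv hB
  have hdiv : ∀ ω, P {ω' | ((∑' a, Y a ω), N.servingFading ω') ∈ B} =
      expNeg (ENNReal.ofReal (γ * p.noise / S)) *
        expNeg (∑' a, ENNReal.ofReal (γ / S) * Y a ω) := by
    intro ω
    refine (prob_le_ofReal_mul hserv hN.servingFading_law
      (ENNReal.ofReal γ * ((∑' a, Y a ω) + ENNReal.ofReal p.noise)) hSpos).trans ?_
    rw [← expNeg_add, ENNReal.tsum_mul_left, ENNReal.ofReal_div_of_pos hSpos,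
      ENNReal.ofReal_div_of_pos hSpos, ENNReal.ofReal_mul hγ, mul_add, ENNReal.add_div, add_comm,
      ENNReal.mul_div_right_comm (b := ∑' a, Y a ω)]
  refine h1.trans ?_
  simp_rw [hdiv]
  rw [lintegral_const_mul]
  · congr 1
    rw [lintegral_expNeg_tsum_of_disjoint_blocks (S := blockSet) hN.indep_marks hN.measurable_mark]
    · congr 1
      refine tsum_congr fun a => ?_
      congr 1
      refine hp.lintegral_expNeg_bsPower t a.1 hθ (norm_nonneg _)
        (hN.measurable_mark (.inr (.inl a))) (hN.obstacle_law _ _)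
        (hN.measurable_mark (.inr (.inr a))) (hN.fading_law _ _) ?_
      exact hN.indep_marks.indepFun (i := .inr (.inl a)) (j := .inr (.inr a)) (by simp)
    · intro a b hab
      simp [blockSet, hab.symm]
    · exact fun a => (hYm a).const_mul _
  · exact measurable_expNeg.comp (Measurable.tsum fun a => (hYm' a).const_mul _)

/-- The coverage probability in terms of the losses caused by the BSs of the two tiers. -/
lemma Network.IsModel.prob_coverage (hN : N.IsModel p P) (hp : p.Valid) (t : Path) {γ r : ℝ}
    (hγ : 0 < γ) (hr : 0 < r) :
    P {ω | ENNReal.ofReal γ ≤ N.sinr p t r ω} =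
      expNeg (ENNReal.ofReal (γ * p.noise / p.rxPower .mbs t r)) *
        ∏ k : Tier, expNeg (∫⁻ x, ENNReal.ofReal (p.bsLoss t (γ / p.rxPower .mbs t r) r k ‖x‖)
          ∂(ENNReal.ofReal (p.density k) • (volume : Measure Plane))) := by
  have hSpos : 0 < p.rxPower .mbs t r := hp.rxPower_pos _ _ hr
  have hθ : 0 ≤ γ / p.rxPower .mbs t r := by positivity
  have hserv : Measurable N.servingFading := hN.measurable_mark (.inl ())
  -- This excludes `0 / 0 = 0` in the SINR, where clearing the denominator would turn a false
  -- inequality into a true one.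
  have hpos : ∀ᵐ ω ∂P, 0 < N.servingFading ω := by
    have h0 : ∀ᵐ h ∂(expMeasure 1), 0 < h := by
      have : IsProbabilityMeasure (expMeasure 1) := isProbabilityMeasure_expMeasure one_pos
      have : NullSingletonClass (expMeasure 1) :=
        ⟨fun x => withDensity_absolutelyContinuous _ _ (measure_singleton x)⟩
      have h1 := expMeasure_Ici le_rfl
      rw [← measure_congr Ioi_ae_eq_Ici, neg_zero, Real.exp_zero, ENNReal.ofReal_one] at h1
      exact (prob_compl_eq_zero_iff measurableSet_Ioi).2 h1
    rw [← hN.servingFading_law] at h0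
    exact ae_of_ae_map hserv.aemeasurable h0
  let B : Set ((Tier → ℕ → Plane) × (MarkIndex → ℝ)) := {z | ENNReal.ofReal γ *
    (p.sumPower t r z.1 z.2 + ENNReal.ofReal p.noise) ≤
      ENNReal.ofReal (z.2 (.inl ()) * p.rxPower .mbs t r)}
  have hB : MeasurableSet B := by
    refine measurableSet_le (Measurable.const_mul (Measurable.add_const ?_ _) _) (by fun_prop)
    exact (measurable_sumPower p t).comp (measurable_const.prodMk measurable_id)
  have h1 : {ω | ENNReal.ofReal γ ≤ N.sinr p t r ω} =ᵐ[P]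
      {ω | ((fun k i => N.pos k i ω), (fun j => N.mark j ω)) ∈ B} := by
    filter_upwards [hpos] with ω hω
    refine propext ?_
    change ENNReal.ofReal γ ≤ N.sinr p t r ω ↔ _
    rw [Network.sinr, N.interference_add, ENNReal.le_div_iff_mul_le]
    · rfl
    · exact .inr (ENNReal.ofReal_pos.2 (mul_pos hω hSpos)).ne'
    · exact .inr ENNReal.ofReal_ne_top
  rw [measure_congr h1, measure_mem_eq_lintegral_of_indepFun hN.indep_pos_marks hN.measurable_pos
    hN.measurable_marks hB]
  have h2 : ∀ ω, P {ω' | ((fun k i => N.pos k i ω), (fun j => N.mark j ω')) ∈ B} = _ :=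
    fun ω => hN.prob_marks hp t hγ.le hr fun k i => N.pos k i ω
  -- Chosen so that `1 - expNeg (G k x)`, the integrand of the Laplace functional, is the loss
  -- itself.
  let G : Tier → Plane → ℝ≥0∞ := fun k x =>
    negLog (ENNReal.ofReal (1 - p.bsLoss t (γ / p.rxPower .mbs t r) r k ‖x‖))
  have hG : ∀ k, Measurable (G k) := by
    intro k
    exact measurable_negLog.comp (((p.measurable_bsLoss t k _ r).comp
      measurable_norm).const_sub 1).ennreal_ofReal
  have hGexp : ∀ k x, expNeg (G k x) =
      ENNReal.ofReal (1 - p.bsLoss t (γ / p.rxPower .mbs t r) r k ‖x‖) := by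
    intro k x
    refine expNeg_negLog ?_
    rw [← ENNReal.ofReal_one]
    exact ENNReal.ofReal_le_ofReal (sub_le_self _ (hp.bsLoss_nonneg t k hθ (norm_nonneg _)))
  have hGsum : ∀ k, Measurable fun y : ℕ → Plane => expNeg (∑' i, G k (y i)) := fun k =>
    measurable_expNeg.comp (Measurable.tsum fun i => (hG k).comp (measurable_pi_apply i))
  have h3 : ∀ ω, expNeg (∑' a : Tier × ℕ, G a.1 (N.pos a.1 a.2 ω)) =
      ∏ k : Tier, expNeg (∑' i, G k (N.pos k i ω)) := by
    intro ω
    rw [ENNReal.tsum_prod', tsum_fintype, expNeg_sum]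
  have hposm : ∀ k, Measurable fun ω i => N.pos k i ω := fun k =>
    measurable_pi_lambda _ (hN.poisson k).1
  simp_rw [h2]
  change ∫⁻ ω, _ * expNeg (∑' a : Tier × ℕ, G a.1 (N.pos a.1 a.2 ω)) ∂P = _
  simp_rw [h3]
  have h4 : Measurable fun ω => ∏ k : Tier, expNeg (∑' i, G k (N.pos k i ω)) :=
    Finset.measurable_fun_prod _ fun k _ => (hGsum k).comp (hposm k)
  rw [lintegral_const_mul _ h4,
    lintegral_prod_eq_prod_lintegral_of_indepFun Finset.univ
      (fun k ω => expNeg (∑' i, G k (N.pos k i ω))) (hN.indep_tiers.comp _ hGsum)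
      (fun k => (hGsum k).comp (hposm k))]
  congr 1
  refine Finset.prod_congr rfl fun k _ => ?_
  have : SigmaFinite (ENNReal.ofReal (p.density k) • (volume : Measure Plane)) :=
    inferInstanceAs (SigmaFinite ((p.density k).toNNReal • (volume : Measure Plane)))
  rw [(hN.poisson k).laplace_functional (hG k)]
  congr 1
  refine lintegral_congr fun x => ?_
  rw [hGexp, ← ENNReal.ofReal_one, ← ENNReal.ofReal_sub _
    (sub_nonneg.2 (hp.bsLoss_le_one t k hθ (norm_nonneg _))), sub_sub_cancel]

end Coverage

/-! ### Polar coordinates and the interference integrals. -/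

lemma lintegral_ofReal_norm_plane {φ : ℝ → ℝ} (hφ : ∀ y, 0 ≤ y → 0 ≤ φ y)
    (hint : IntegrableOn (fun y => y * φ y) (Set.Ioi 0)) {d : ℝ} (hd : 0 ≤ d) :
    ∫⁻ x, ENNReal.ofReal (φ ‖x‖) ∂(ENNReal.ofReal d • (volume : Measure Plane)) =
      ENNReal.ofReal (2 * Real.pi * d * ∫ y in Set.Ioi 0, y * φ y) := by
  have hdim : Module.finrank ℝ Plane = 2 := finrank_euclideanSpace_fin
  have hball : (volume : Measure Plane).real (Metric.ball 0 1) = Real.pi := by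
    rw [measureReal_def, EuclideanSpace.volume_ball_fin_two]
    simp [Real.pi_nonneg]
  have h1 : Integrable (fun x : Plane => φ ‖x‖) volume := by
    rw [integrable_fun_norm_addHaar, hdim]
    simpa using hint
  have h2 : ∫ x : Plane, φ ‖x‖ = 2 * Real.pi * ∫ y in Set.Ioi 0, y * φ y := by
    rw [integral_fun_norm_addHaar, hdim, hball]
    simp [mul_assoc]
  rw [lintegral_smul_measure, ← ofReal_integral_eq_lintegral_ofReal h1
    (.of_forall fun x => hφ _ (norm_nonneg x)), h2, smul_eq_mul, ← ENNReal.ofReal_mul hd]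
  congr 1; ring

namespace Params

variable {p : Params}

/-- For an exponent above 2 the power alone is integrable. Otherwise the link is LoS with `β > 0`,
and the bound `18 / x + exp (-β x)` on its probability gains the missing power of `x` up to an
exponentially small term. -/
lemma Valid.integrableOn_pathProb_mul_rpow (hp : p.Valid) (u : Path) {c : ℝ} (hc : 0 < c) :
    IntegrableOn (fun x => p.pathProb u x * x ^ (1 - p.exponent u)) (Set.Ioi c) := by
  have hm : AEStronglyMeasurable (fun x => p.pathProb u x * x ^ (1 - p.exponent u))
      (volume.restrict (Set.Ioi c)) := by
    refine Measurable.aestronglyMeasurable ?_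
    fun_prop
  have hnorm : ∀ x, 0 < x → ‖p.pathProb u x * x ^ (1 - p.exponent u)‖ =
      p.pathProb u x * x ^ (1 - p.exponent u) := fun x hx =>
    Real.norm_of_nonneg (mul_nonneg (hp.pathProb_nonneg u hx.le) (Real.rpow_nonneg hx.le _))
  by_cases hu : 2 < p.exponent u
  · refine Integrable.mono' (integrableOn_Ioi_rpow_of_lt (a := 1 - p.exponent u) (by linarith) hc)
      hm ?_
    filter_upwards [ae_restrict_mem measurableSet_Ioi] with x (hx : c < x)
    have hx0 : 0 < x := hc.trans hx
    rw [hnorm x hx0]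
    exact mul_le_of_le_one_left (Real.rpow_nonneg hx0.le _) (hp.pathProb_le_one u hx0.le)
  · have hlos : u = .los := by
      cases u
      · rfl
      · exact absurd hp.two_lt_exponent_nlos hu
    subst hlos
    have hβ : 0 < p.blockage :=
      hp.blockage_nonneg.lt_of_ne fun h => hu (hp.two_lt_exponent_los h.symm)
    have h1 := hp.one_lt_exponent .los
    have hi1 : IntegrableOn (fun x : ℝ => 18 * x ^ (-p.exponent .los)) (Set.Ioi c) :=
      (integrableOn_Ioi_rpow_of_lt (by linarith) hc).const_mul 18
    have hi2 : IntegrableOn (fun x : ℝ => c ^ (1 - p.exponent .los) *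
        Real.exp (-p.blockage * x)) (Set.Ioi c) :=
      (exp_neg_integrableOn_Ioi c hβ).const_mul _
    refine Integrable.mono' (hi1.add hi2) hm ?_
    filter_upwards [ae_restrict_mem measurableSet_Ioi] with x (hx : c < x)
    have hx0 : 0 < x := hc.trans hx
    rw [hnorm x hx0]
    have hpow : x ^ (1 - p.exponent .los) ≤ c ^ (1 - p.exponent .los) :=
      Real.rpow_le_rpow_of_nonpos hc hx.le (by linarith)
    have hpow0 : 0 ≤ x ^ (1 - p.exponent .los) := Real.rpow_nonneg hx0.le _
    have hexp := Real.exp_pos (-p.blockage * x)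
    have hP : p.pathProb .los x ≤ 18 / x + Real.exp (-p.blockage * x) := by
      have h2 : 0 ≤ min (18 / x) 1 := le_min (by positivity) zero_le_one
      have h3 : min (18 / x) 1 * (1 - Real.exp (-p.blockage * x)) ≤ min (18 / x) 1 :=
        mul_le_of_le_one_right h2 (by linarith)
      have h4 : min (18 / x) 1 ≤ 18 / x := min_le_left _ _
      unfold pathProb
      linarith
    calc p.pathProb .los x * x ^ (1 - p.exponent .los)
        ≤ (18 / x + Real.exp (-p.blockage * x)) * x ^ (1 - p.exponent .los) :=
          mul_le_mul_of_nonneg_right hP hpow0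
      _ = 18 * x ^ (-p.exponent .los) +
          x ^ (1 - p.exponent .los) * Real.exp (-p.blockage * x) := by
          rw [sub_eq_add_neg, Real.rpow_add hx0, Real.rpow_one]
          field_simp
      _ ≤ _ := by
          simp only [Pi.add_apply]
          gcongr

/-- Dropping the 1 from the denominator leaves a constant multiple of the integrand of
`integrableOn_pathProb_mul_rpow`. -/
lemma Valid.integrableOn_interference (hp : p.Valid) (t : Path) (k : Tier) (u : Path) {γ r : ℝ}
    (hγ : 0 < γ) (hr : 0 < r) :
    IntegrableOn (fun x => p.pathProb u x * x /
      (1 + p.rxPower .mbs t r / (γ * p.rxPower k u x))) (Set.Ioi (p.exclusion t k u r)) := by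
  have hS : 0 < p.rxPower .mbs t r := hp.rxPower_pos _ _ hr
  have hc := hp.exclusion_pos t k u hr
  have hm : Measurable fun x => p.pathProb u x * x /
      (1 + p.rxPower .mbs t r / (γ * p.rxPower k u x)) := by fun_prop
  refine Integrable.mono' ((hp.integrableOn_pathProb_mul_rpow u hc).const_mul
    (γ * (p.txPower k * p.bias k * p.gain u) / p.rxPower .mbs t r)) hm.aestronglyMeasurable ?_
  filter_upwards [ae_restrict_mem measurableSet_Ioi] with x (hx : _ < x)
  have hx0 : 0 < x := hc.trans hx
  have hrx := hp.rxPower_pos k u hx0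
  have hP := hp.pathProb_nonneg u hx0.le
  have hPx : 0 ≤ p.pathProb u x * x := mul_nonneg hP hx0.le
  rw [Real.norm_of_nonneg (div_nonneg hPx (by positivity))]
  calc p.pathProb u x * x / (1 + p.rxPower .mbs t r / (γ * p.rxPower k u x))
      ≤ p.pathProb u x * x / (p.rxPower .mbs t r / (γ * p.rxPower k u x)) :=
        div_le_div_of_nonneg_left hPx (by positivity) (by linarith)
    _ = γ * p.rxPower k u x / p.rxPower .mbs t r * (p.pathProb u x * x) := by
        field_simp
    _ = _ := by
        rw [sub_eq_add_neg, Real.rpow_add hx0, Real.rpow_one, rxPower, pathLoss]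
        ring

/-- With `θ = γ / S`, this is `θ s / (1 + θ s) = 1 / (1 + S / (γ s))`. The half-line is closed
because ties in the association rule interfere; the endpoint is null for the integrals. -/
lemma Valid.mul_linkLoss_eq_indicator (hp : p.Valid) (t : Path) (k : Tier) (u : Path) {γ r : ℝ}
    (hγ : 0 < γ) (hr : 0 < r) {y : ℝ} (hy : 0 < y) :
    y * (p.pathProb u y * p.linkLoss t (γ / p.rxPower .mbs t r) r k u y) =
      (Set.Ici (p.exclusion t k u r)).indicator (fun x => p.pathProb u x * x /
        (1 + p.rxPower .mbs t r / (γ * p.rxPower k u x))) y := by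
  have hS : 0 < p.rxPower .mbs t r := hp.rxPower_pos _ _ hr
  have hrx := hp.rxPower_pos k u hy
  rw [linkLoss]
  by_cases h : p.exclusion t k u r ≤ y
  · rw [if_pos ((hp.assocPower_le_iff t k u hy hr).2 h), Set.indicator_of_mem (Set.mem_Ici.2 h)]
    field_simp
    ring
  · rw [if_neg (mt (hp.assocPower_le_iff t k u hy hr).1 h),
      Set.indicator_of_notMem (mt Set.mem_Ici.1 h), mul_zero, mul_zero]

lemma Valid.integrableOn_mul_linkLoss (hp : p.Valid) (t : Path) (k : Tier) (u : Path) {γ r : ℝ}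
    (hγ : 0 < γ) (hr : 0 < r) :
    IntegrableOn (fun y => y * (p.pathProb u y * p.linkLoss t (γ / p.rxPower .mbs t r) r k u y))
      (Set.Ioi 0) := by
  refine IntegrableOn.congr_fun ?_
    (fun y hy => (hp.mul_linkLoss_eq_indicator t k u hγ hr hy).symm) measurableSet_Ioi
  refine Integrable.integrableOn ?_
  rw [integrable_indicator_iff measurableSet_Ici, integrableOn_Ici_iff_integrableOn_Ioi]
  exact hp.integrableOn_interference t k u hγ hr

lemma Valid.integral_mul_linkLoss (hp : p.Valid) (t : Path) (k : Tier) (u : Path) {γ r : ℝ}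
    (hγ : 0 < γ) (hr : 0 < r) :
    ∫ y in Set.Ioi 0, y * (p.pathProb u y * p.linkLoss t (γ / p.rxPower .mbs t r) r k u y) =
      p.interferenceIntegral t k u γ r := by
  rw [setIntegral_congr_fun measurableSet_Ioi
    (fun y hy => hp.mul_linkLoss_eq_indicator t k u hγ hr hy),
    setIntegral_indicator measurableSet_Ici, Set.inter_eq_right.2
      (Set.Ici_subset_Ioi.2 (hp.exclusion_pos t k u hr)), integral_Ici_eq_integral_Ioi]
  rfl

lemma Valid.interferenceIntegral_nonneg (hp : p.Valid) (t : Path) (k : Tier) (u : Path) {γ r : ℝ}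
    (hγ : 0 < γ) (hr : 0 < r) : 0 ≤ p.interferenceIntegral t k u γ r := by
  have hS : 0 < p.rxPower .mbs t r := hp.rxPower_pos _ _ hr
  rw [← hp.integral_mul_linkLoss t k u hγ hr]
  refine setIntegral_nonneg measurableSet_Ioi fun y (hy : 0 < y) => ?_
  exact mul_nonneg hy.le (mul_nonneg (hp.pathProb_nonneg u hy.le)
    (hp.linkLoss_nonneg t k (by positivity) u hy.le))

lemma Valid.expNeg_lintegral_bsLoss (hp : p.Valid) (t : Path) (k : Tier) {γ r : ℝ}
    (hγ : 0 < γ) (hr : 0 < r) :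
    expNeg (∫⁻ x, ENNReal.ofReal (p.bsLoss t (γ / p.rxPower .mbs t r) r k ‖x‖)
        ∂(ENNReal.ofReal (p.density k) • (volume : Measure Plane))) =
      ENNReal.ofReal (Real.exp (-2 * Real.pi * p.density k *
        (p.interferenceIntegral t k .los γ r + p.interferenceIntegral t k .nlos γ r))) := by
  have hS : 0 < p.rxPower .mbs t r := hp.rxPower_pos _ _ hr
  have hd := hp.density_pos k
  have h1 := hp.interferenceIntegral_nonneg t k .los hγ hr
  have h2 := hp.interferenceIntegral_nonneg t k .nlos hγ hr
  have hi1 := hp.integrableOn_mul_linkLoss t k .los hγ hr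
  have hi2 := hp.integrableOn_mul_linkLoss t k .nlos hγ hr
  have hsum : ∀ y, y * p.bsLoss t (γ / p.rxPower .mbs t r) r k y =
      y * (p.pathProb .los y * p.linkLoss t (γ / p.rxPower .mbs t r) r k .los y) +
        y * (p.pathProb .nlos y * p.linkLoss t (γ / p.rxPower .mbs t r) r k .nlos y) := by
    intro y
    rw [bsLoss, mul_add]
  rw [lintegral_ofReal_norm_plane (fun y hy => hp.bsLoss_nonneg t k (by positivity) hy) _ hd.le]
  · simp_rw [hsum]
    rw [integral_add hi1 hi2, hp.integral_mul_linkLoss t k .los hγ hr,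
      hp.integral_mul_linkLoss t k .nlos hγ hr, expNeg_ofReal (by positivity)]
    congr 2; ring
  · simp_rw [hsum]
    exact hi1.add hi2

end Params

/-! ### Averaging over the serving link. -/

section Main

variable {Ω : Type*} [MeasurableSpace Ω] {P : Measure Ω} [IsProbabilityMeasure P] {p : Params}
  {N : Network Ω}

lemma Network.IsModel.prob_coverage_eq (hN : N.IsModel p P) (hp : p.Valid) (t : Path) {γ r : ℝ}
    (hγ : 0 < γ) (hr : 0 < r) :
    P.real {ω | ENNReal.ofReal γ ≤ N.sinr p t r ω} =
      Real.exp (-γ * p.noise / p.rxPower .mbs t r) * p.laplace t γ r := by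
  have hS : 0 < p.rxPower .mbs t r := hp.rxPower_pos _ _ hr
  have hn := hp.noise_nonneg
  rw [measureReal_def, hN.prob_coverage hp t hγ hr, prod_tier,
    hp.expNeg_lintegral_bsLoss t _ hγ hr, hp.expNeg_lintegral_bsLoss t _ hγ hr,
    expNeg_ofReal (by positivity), ENNReal.toReal_mul, ENNReal.toReal_mul,
    ENNReal.toReal_ofReal (Real.exp_pos _).le, ENNReal.toReal_ofReal (Real.exp_pos _).le,
    ENNReal.toReal_ofReal (Real.exp_pos _).le, Params.laplace,
    ← neg_div, ← neg_mul]

theorem Network.IsModel.pathCoverage_eq (hN : N.IsModel p P) (hp : p.Valid) (t : Path) {γ : ℝ}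
    (hγ : 0 < γ) : N.pathCoverage p P t γ = p.coverageIntegral t γ := by
  rw [Network.pathCoverage, hN.assocLaw_eq hp t, integral_withDensity_eq_integral_toReal_smul
    (p.measurable_assocDensity t).ennreal_ofReal (.of_forall fun _ => ENNReal.ofReal_lt_top)]
  refine setIntegral_congr_fun measurableSet_Ioi fun r (hr : 0 < r) => ?_
  simp only [hN.prob_coverage_eq hp t hγ hr, smul_eq_mul,
    ENNReal.toReal_ofReal (hp.assocDensity_nonneg t hr.le)]
  ring

/-- The joint law is a sum of two measures, each concentrated on one link type; Fubini evaluates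
each as an integral over the length. -/
theorem Network.IsModel.tierCoverage_eq (hN : N.IsModel p P) (hp : p.Valid) (γ : ℝ) :
    N.tierCoverage p P γ = N.pathCoverage p P .los γ + N.pathCoverage p P .nlos γ := by
  have hfin := hN.isFiniteMeasure_assocLaw hp
  let A : Set ((Path × ℝ) × Ω) := {z | ENNReal.ofReal γ ≤ N.sinr p z.1.1 z.1.2 z.2}
  have hsinr : Measurable fun z : Path × (ℝ × Ω) => N.sinr p z.1 z.2.1 z.2.2 :=
    -- There are only two link types, so joint measurability may be checked for each one separately.
    measurable_from_prod_countable_right fun t => hN.measurable_sinr t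
  have hA : MeasurableSet A := measurableSet_le measurable_const
    (hsinr.comp (f := fun z : (Path × ℝ) × Ω => (z.1.1, z.1.2, z.2)) (by fun_prop))
  have hone : ∀ t, (((Measure.dirac t).prod (N.assocLaw p P t)).prod P).real A =
      N.pathCoverage p P t γ := by
    intro t
    rw [measureReal_def, Measure.prod_apply hA, Measure.dirac_prod,
      lintegral_map (measurable_measure_prodMk_left hA) measurable_prodMk_left,
      Network.pathCoverage]
    simp only [measureReal_def]
    rw [integral_toReal]
    · rfl
    · exact ((measurable_measure_prodMk_left hA).comp measurable_prodMk_left).aemeasurable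
    · exact .of_forall fun _ => measure_lt_top _ _
  rw [Network.tierCoverage, Network.linkLaw, Measure.add_prod, measureReal_add_apply]
  exact congrArg₂ _ (hone .los) (hone .nlos)

end Main

end HetNet

theorem mainTheorem8 {Ω : Type*} [MeasurableSpace Ω] (P : MeasureTheory.Measure Ω)
    [MeasureTheory.IsProbabilityMeasure P]
    (p : HetNet.Params) (N : HetNet.Network Ω) (hN : N.IsModel p P)
    (h_density : ∀ k, 0 < p.density k)
    (h_power : ∀ k, 0 < p.txPower k)
    (h_bias : ∀ k, 0 < p.bias k)
    (h_assocFading : ∀ k, 0 < p.assocFading k)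
    (h_gain : ∀ t, 0 < p.gain t)
    (h_blockage : 0 ≤ p.blockage)
    (h_noise : 0 ≤ p.noise)
    -- the path loss exponents for which the interference is finite
    (h_los : 1 < p.exponent .los)
    (h_los' : p.blockage = 0 → 2 < p.exponent .los)
    (h_nlos : 2 < p.exponent .nlos)
    (η γ₀ : ℝ) (h_η : η ∈ Set.Icc (0 : ℝ) 1) (h_γ₀ : 0 < γ₀) :
    N.throughput p P η γ₀ =
        p.density .mbs * η * p.bandwidth * Real.logb 2 (1 + γ₀) * N.pathCoverage p P .los γ₀ +
        p.density .mbs * η * p.bandwidth * Real.logb 2 (1 + γ₀) * N.pathCoverage p P .nlos γ₀ ∧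
      ∀ t, N.pathCoverage p P t γ₀ = p.coverageIntegral t γ₀ := by
  have hp : p.Valid :=
    { density_pos := h_density
      txPower_pos := h_power
      bias_pos := h_bias
      assocFading_pos := h_assocFading
      gain_pos := h_gain
      blockage_nonneg := h_blockage
      noise_nonneg := h_noise
      one_lt_exponent := by
        rintro ⟨⟩
        · exact h_los
        · exact one_lt_two.trans h_nlos
      two_lt_exponent_los := h_los'
      two_lt_exponent_nlos := h_nlos }
  refine ⟨?_, fun t => hN.pathCoverage_eq hp t h_γ₀⟩
  rw [HetNet.Network.throughput, hN.tierCoverage_eq hp]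
  ring
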